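/- Let $n\ge 2$. Let $W$ be the Weyl group of type $D_{n+1}$ (with $D_3=A_3$), with simple roots $\alpha_i=\varepsilon_i-\varepsilon_{i+1}$ $(1\le i\le n)$, $\alpha_{n+1}=\varepsilon_n+\varepsilon_{n+1}$, index set $I=\{1,\dots,n+1\}$, simple reflections $s_i$, positive roots $\Phi^+$, longest element $w_0$, and $w_0(\alpha_i)=-\alpha_{i^*}$. Let $\vee$ be the diagram automorphism exchanging $n$ and $n+1$ and fixing the other indices; it acts linearly by permuting the simple roots. * Two words in $I$ are commutation equivalent if they are related by relations $s_is_j=s_js_i$; $[\mathbf i]$ is the commutation class of $\mathbf i$. The reflection functors send $[i_1i_2\cdots i_\ell]$ to $[i_2\cdots i_\ell i_1^*]$ and to $[i_\ell^* i_1\cdots i_{\ell-1}]$, for $i_1i_2\cdots i_\ell$ a reduced word of $w_0$. A *twisted adapted class* is a commutation class obtained by reflection functors from the class of $\prod_{k=0}^{n}(1\,2\cdots n)^{k\vee}$, where $(i_1\cdots i_n)^{k\vee}$ is the word obtained by applying $\vee$ $k$ times to each letter. * A *twisted Coxeter element* is a linear map $(s_{i_1}\cdots s_{i_n})\vee$ where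 $i_1,\dots,i_n$ are representatives, in any order, of the $n$ orbits of $\vee$ on $I$. * A *twisted Dynkin quiver* $Q^{\leftarrow}$ is an orientation of the edges of the path with vertices $1,2,\dots,n-1$ and a last vertex labelled either $\binom{n}{n+1}$ or $\binom{n+1}{n}$; the lower index of the last vertex is hidden. A non-hidden index $i$ is a sink (source) if all arrows at its vertex enter (leave) it; a hidden index is neither. If $i$ is a sink or a source, $iQ^{\leftarrow}$ is obtained by reversing all arrows at its vertex and, if $i\in\{n,n+1\}$, exchanging the two indices of the last vertex; otherwise $iQ^{\leftarrow}=Q^{\leftarrow}$. A word $i_1i_2\cdots i_\ell$ is *adapted* to $Q^{\leftarrow}$ if $i_k$ is a sink of $i_{k-1}\cdots i_1Q^{\leftarrow}$ for all $k$. Let $[Q^{\leftarrow}]$ be the set of reduced words of $w_0$ adapted to $Q^{\leftarrow}$. * For a reduced word $\mathbf i=i_1\cdots i_\ell$ of $w_0$ put $\beta_k^{\mathbf i}=s_{i_1}\cdots s_{i_{k-1}}(\alpha_{i_k})$, and $\beta_k^{\mathbf i}<_{\mathbf i}\beta_l^{\mathbf i}$ iff $k<l$. For a commutation class $c$ of such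 words, $\alpha\prec_c\beta$ iff $\alpha<_{\mathbf i}\beta$ for all $\mathbf i\in c$. The *convex partial orders* considered are the $\prec_c$ with $c$ a twisted adapted class. * The combinatorial AR-quiver $\Upsilon_{\mathbf i}$ has vertex set $\Phi^+$, with $\beta_k^{\mathbf i}$ in residue $i_k$, and an arrow $\beta_k^{\mathbf i}\to\beta_j^{\mathbf i}$ iff $i_k,i_j$ are adjacent in the Dynkin diagram, $j=\max\{j'<k: i_{j'}=i_j\}$ and $k=\min\{k'>j: i_{k'}=i_k\}$. The *twisted AR-quivers* are the $\Upsilon_{\mathbf i}$ with $\mathbf i$ in a twisted adapted class (as quivers on $\Phi^+$ with residues). **Theorem.** For every twisted Dynkin quiver $Q^{\leftarrow}$ there are words $i_1\cdots i_n$ of representatives of the $\vee$-orbits adapted to $Q^{\leftarrow}$, and all of them give the same twisted Coxeter element $\phi_{Q^{\leftarrow}}=(s_{i_1}\cdots s_{i_n})\vee$. The quiver $\Upsilon_{\mathbf i}$ is the same for all $\mathbf i\in[Q^{\leftarrow}]$; call it $\Upsilon_{[Q^{\leftarrow}]}$. Whenever $j_1,\dots,j_n$ are representatives of the $\vee$-orbits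 with $\phi_{Q^{\leftarrow}}=(s_{j_1}\cdots s_{j_n})\vee$, one has $[Q^{\leftarrow}]=\big[\prod_{k=0}^{n}(j_1\cdots j_n)^{k\vee}\big]$. The maps $$Q^{\leftarrow}\mapsto[Q^{\leftarrow}],\qquad Q^{\leftarrow}\mapsto\phi_{Q^{\leftarrow}},\qquad Q^{\leftarrow}\mapsto\prec_{[Q^{\leftarrow}]},\qquad Q^{\leftarrow}\mapsto\Upsilon_{[Q^{\leftarrow}]}$$ are bijections from the set of twisted Dynkin quivers onto, respectively, the set of twisted adapted classes, of twisted Coxeter elements, of convex partial orders $\prec_c$ of twisted adapted classes $c$, and of twisted AR-quivers. Hence these five families are in canonical one-to-one correspondence, and each has exactly $2^n$ members. -/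

import Mathlib

noncomputable section

namespace TwistedD

/-!
Type `D_{n+1}` is realised in `ℝ^{n+1}`.  The index `i : Fin (n+1)` stands for the vertex
`i + 1` of the Dynkin diagram, so that the two vertices of the fork are `n - 1` and `n`.
The standing assumption is `2 ≤ n`.
-/

/-- The ambient space of the root system. -/
abbrev V (n : ℕ) : Type := Fin (n + 1) → ℝ

/-- Words in the index set of the Dynkin diagram. -/
abbrev Word (n : ℕ) : Type := List (Fin (n + 1))

/-- The standard basis vector `ε_a`. -/
def eps (n : ℕ) (a : Fin (n + 1)) : V n := Pi.single a 1

/-- The simple roots: `ε_i - ε_{i+1}` for every index but the last one, and the sum of the last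
two basis vectors for the last index. -/
def simpleRoot (n : ℕ) (i : Fin (n + 1)) : V n :=
  if h : (i : ℕ) < n then eps n i - eps n ⟨i + 1, by omega⟩
  else eps n ⟨n - 1, by omega⟩ + eps n (Fin.last n)

/-- The positive roots `ε_a - ε_b` and `ε_a + ε_b` with `a < b`. -/
def IsPosRoot (n : ℕ) (v : V n) : Prop :=
  ∃ a b : Fin (n + 1), a < b ∧ (v = eps n a - eps n b ∨ v = eps n a + eps n b)

/-- The set `Φ⁺` of positive roots, as a type. -/
abbrev PosRoot (n : ℕ) : Type := {v : V n // IsPosRoot n v}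

/-- Two indices are joined in the Dynkin diagram. -/
def Adj (n : ℕ) (i j : Fin (n + 1)) : Prop := simpleRoot n i ⬝ᵥ simpleRoot n j = -1

/-- The simple reflection `v ↦ v - (v, α_i) α_i` (every root has `(α, α) = 2`). -/
def simpleRefl (n : ℕ) (i : Fin (n + 1)) : Module.End ℝ (V n) where
  toFun v := v - (v ⬝ᵥ simpleRoot n i) • simpleRoot n i
  map_add' u v := by rw [add_dotProduct, add_smul]; abel
  map_smul' c v := by
    rw [smul_dotProduct, smul_eq_mul, mul_smul, RingHom.id_apply, smul_sub]

/-- The element `s_{i_1} s_{i_2} ⋯ s_{i_l}` of the Weyl group. -/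
def wordProd (n : ℕ) (w : Word n) : Module.End ℝ (V n) := (w.map (simpleRefl n)).prod

/-- A word is reduced if no shorter word represents the same element. -/
def IsReduced (n : ℕ) (w : Word n) : Prop :=
  ∀ u : Word n, wordProd n u = wordProd n w → w.length ≤ u.length

/-- Reduced words of the longest element `w_0`. -/
def IsLongestWord (n : ℕ) (w : Word n) : Prop :=
  IsReduced n w ∧ ∀ u : Word n, IsReduced n u → u.length ≤ w.length

/-- One application of a commutation relation `s_i s_j = s_j s_i` to a word. -/
def CommStep (n : ℕ) (u v : Word n) : Prop :=
  ∃ (a b : Word n) (i j : Fin (n + 1)),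
    simpleRefl n i * simpleRefl n j = simpleRefl n j * simpleRefl n i ∧
      u = a ++ i :: j :: b ∧ v = a ++ j :: i :: b

/-- The commutation class of a word, as a set of words. -/
def commClass (n : ℕ) (w : Word n) : Set (Word n) := {u | Relation.EqvGen (CommStep n) w u}

/-- The nontrivial applications of the reflection functors to commutation classes.
If `i i_2 ⋯ i_l` lies in the class `c`, then `c r_i` is the class of `i_2 ⋯ i_l i^*`;
if `i_1 ⋯ i_{l-1} i` lies in `c`, then `r_i c` is the class of `i^* i_1 ⋯ i_{l-1}`.
Here `i^*` is the index with `w_0 (α_i) = - α_{i^*}`. -/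
def ReflectionStep (n : ℕ) (c c' : Set (Word n)) : Prop :=
  (∃ (i j : Fin (n + 1)) (w : Word n), i :: w ∈ c ∧
      wordProd n (i :: w) (simpleRoot n i) = -simpleRoot n j ∧ c' = commClass n (w ++ [j])) ∨
  (∃ (i j : Fin (n + 1)) (w : Word n), w ++ [i] ∈ c ∧
      wordProd n (w ++ [i]) (simpleRoot n i) = -simpleRoot n j ∧ c' = commClass n (j :: w))

/-- The `r`-cluster point of a class: all classes obtained from it by reflection functors. -/
def clusterPoint (n : ℕ) (c : Set (Word n)) : Set (Set (Word n)) :=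
  {c' | Relation.ReflTransGen (ReflectionStep n) c c'}

/-- The diagram automorphism `∨`, interchanging the two vertices of the fork. -/
def vee (n : ℕ) : Equiv.Perm (Fin (n + 1)) := Equiv.swap ⟨n - 1, by omega⟩ (Fin.last n)

/-- The linear map permuting the simple roots according to `∨`: it changes the sign of the last
coordinate. -/
def sigma (n : ℕ) : Module.End ℝ (V n) where
  toFun v := fun a => if a = Fin.last n then -v a else v a
  map_add' u v := by
    ext a
    by_cases h : a = Fin.last n <;> simp [h, add_comm]
  map_smul' c v := by
    ext a
    by_cases h : a = Fin.last n <;> simp [h]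

/-- The map `sigma` permutes the simple roots according to `∨`. -/
theorem sigma_simpleRoot (n : ℕ) (hn : 1 ≤ n) (i : Fin (n + 1)) :
    sigma n (simpleRoot n i) = simpleRoot n (vee n i) := by
  obtain ⟨m, rfl⟩ : ∃ m, n = m + 1 := ⟨n - 1, by omega⟩
  obtain ⟨i, hi⟩ := i
  rcases (by omega : i < m ∨ i = m ∨ i = m + 1) with h | h | h
  · have h1 : vee (m + 1) ⟨i, hi⟩ = ⟨i, hi⟩ := by
      apply Equiv.swap_apply_of_ne_of_ne <;> simp [Fin.ext_iff] <;> omega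
    rw [h1]
    ext a
    simp only [sigma, simpleRoot, eps, LinearMap.coe_mk, AddHom.coe_mk]
    rw [dif_pos (by simp; omega)]
    simp only [Pi.sub_apply, Pi.single_apply, Fin.ext_iff, Fin.val_last]
    split_ifs <;> first | omega | simp
  · subst h
    have h1 : vee (i + 1) ⟨i, hi⟩ = Fin.last (i + 1) := by simp [vee]
    rw [h1]
    ext a
    simp only [sigma, simpleRoot, eps, LinearMap.coe_mk, AddHom.coe_mk]
    rw [dif_pos (by simp), dif_neg (by simp)]
    simp only [Pi.sub_apply, Pi.add_apply, Pi.single_apply, Fin.ext_iff, Fin.val_last]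
    split_ifs <;> first | omega | simp
  · subst h
    have h1 : vee (m + 1) ⟨m + 1, hi⟩ = ⟨m, by omega⟩ := by
      have : (⟨m + 1, hi⟩ : Fin (m + 1 + 1)) = Fin.last (m + 1) := rfl
      rw [this]; simp [vee]
    rw [h1]
    ext a
    simp only [sigma, simpleRoot, eps, LinearMap.coe_mk, AddHom.coe_mk]
    rw [dif_neg (by simp), dif_pos (by simp)]
    simp only [Pi.sub_apply, Pi.add_apply, Pi.single_apply, Fin.ext_iff, Fin.val_last]
    split_ifs <;> first | omega | simp

/-- The word `∏_{k=0}^{n} (i_1 i_2 ⋯ i_m)^{k∨}`. -/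
def twistedPower (n : ℕ) (w : Word n) : Word n :=
  (List.range (n + 1)).flatMap fun k => w.map ((vee n)^[k])

/-- The twisted adapted classes: the members of the cluster point of
`∏_{k=0}^{n} (1 2 ⋯ n)^{k∨}`, the twisted adapted cluster point. -/
def twistedAdaptedClasses (n : ℕ) : Set (Set (Word n)) :=
  clusterPoint n (commClass n (twistedPower n ((List.finRange n).map Fin.castSucc)))

/-- The word contains exactly one letter, exactly once, from each orbit `{i, i^∨}`. -/
def IsTransversal (n : ℕ) (w : Word n) : Prop :=
  ∀ i : Fin (n + 1), w.countP (fun j => decide (j = i ∨ j = vee n i)) = 1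

/-- The element `(s_{i_1} ⋯ s_{i_n}) ∨`. -/
def coxeterOf (n : ℕ) (w : Word n) : Module.End ℝ (V n) := wordProd n w * sigma n

/-- The twisted Coxeter elements. -/
def twistedCoxeterElements (n : ℕ) : Set (Module.End ℝ (V n)) :=
  {f | ∃ w : Word n, IsTransversal n w ∧ f = coxeterOf n w}

/-- A twisted Dynkin quiver: an orientation of a path with `n` vertices (numbered from `0`), the
last of which carries both indices `n - 1` and `n` of the fork, one of them being on top. -/
@[ext]
structure TwistedDynkinQuiver (n : ℕ) where
  /-- `false` if `n - 1` is on top of the last vertex (and `n` is hidden below it),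
  `true` if `n` is on top (and `n - 1` is hidden below it). -/
  swapped : Bool
  /-- The edge `k` joins the vertices `k` and `k + 1` of the path; `true` means `k → k + 1`,
  `false` means `k + 1 → k`. -/
  toRight : Fin (n - 1) → Bool

namespace TwistedDynkinQuiver

variable {n : ℕ}

/-- The vertex of the path that carries the index `i`. -/
def vertex (n : ℕ) (i : Fin (n + 1)) : ℕ := min (i : ℕ) (n - 1)

/-- The index `i` is not the hidden one. -/
def IsVisible (Q : TwistedDynkinQuiver n) (i : Fin (n + 1)) : Prop :=
  (i : ℕ) < n - 1 ∨ ((i : ℕ) = n - 1 ∧ Q.swapped = false) ∨ ((i : ℕ) = n ∧ Q.swapped = true)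

/-- The index `i` is a sink: it is visible, and all edges at its vertex point to that vertex. -/
def IsSink (Q : TwistedDynkinQuiver n) (i : Fin (n + 1)) : Prop :=
  Q.IsVisible i ∧
    (∀ k : Fin (n - 1), (k : ℕ) = vertex n i → Q.toRight k = false) ∧
    (∀ k : Fin (n - 1), (k : ℕ) + 1 = vertex n i → Q.toRight k = true)

/-- The index `i` is a source: it is visible, and all edges at its vertex leave that vertex. -/
def IsSource (Q : TwistedDynkinQuiver n) (i : Fin (n + 1)) : Prop :=
  Q.IsVisible i ∧
    (∀ k : Fin (n - 1), (k : ℕ) = vertex n i → Q.toRight k = true) ∧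
    (∀ k : Fin (n - 1), (k : ℕ) + 1 = vertex n i → Q.toRight k = false)

open Classical in
/-- The reflection `i Q`.  If `i` is a sink or a source, all edges at its vertex are reversed, and
if moreover `i` belongs to the fork, the two indices of the last vertex are interchanged.
Otherwise `i Q = Q`.  (A visible index of the fork is always a sink or a source.) -/
def reflect (Q : TwistedDynkinQuiver n) (i : Fin (n + 1)) : TwistedDynkinQuiver n :=
  if Q.IsSink i ∨ Q.IsSource i then
    { swapped := if vertex n i = n - 1 then !Q.swapped else Q.swapped
      toRight := fun k =>
        if (k : ℕ) = vertex n i ∨ (k : ℕ) + 1 = vertex n i then !Q.toRight k else Q.toRight k }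
  else Q

/-- The word `i_1 i_2 ⋯ i_l` is adapted to `Q`: each `i_k` is a sink of
`i_{k-1} ⋯ i_2 i_1 Q`. -/
def Adapted (Q : TwistedDynkinQuiver n) : Word n → Prop
  | [] => True
  | i :: w => Q.IsSink i ∧ (Q.reflect i).Adapted w

/-- The set `[Q]` of reduced words of `w_0` adapted to `Q`. -/
def adaptedClass (Q : TwistedDynkinQuiver n) : Set (Word n) :=
  {w | IsLongestWord n w ∧ Q.Adapted w}

end TwistedDynkinQuiver

/-- The vector `s_{i_1} ⋯ s_{i_{k-1}} (α_{i_k})` attached to the `k`-th letter of a word. -/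
def wordRoot (n : ℕ) (w : Word n) (k : Fin w.length) : V n :=
  wordProd n (w.take k) (simpleRoot n (w.get k))

/-- The convex total order `<_w` on `Φ⁺` given by a reduced word `w` of `w_0`. -/
def wordOrder (n : ℕ) (w : Word n) (α β : PosRoot n) : Prop :=
  ∃ k l : Fin w.length, k < l ∧ wordRoot n w k = α.1 ∧ wordRoot n w l = β.1

/-- The convex partial order `≺_c` of a class `c` of reduced words of `w_0`. -/
def convexOrder (n : ℕ) (c : Set (Word n)) (α β : PosRoot n) : Prop :=
  ∀ w ∈ c, wordOrder n w α β

/-- The convex partial orders of the twisted adapted classes. -/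
def twistedConvexOrders (n : ℕ) : Set (PosRoot n → PosRoot n → Prop) :=
  {r | ∃ c ∈ twistedAdaptedClasses n, r = convexOrder n c}

/-- A quiver whose vertices are the positive roots, each vertex being placed in residues. -/
@[ext]
structure RootQuiver (n : ℕ) where
  /-- `residue β i`: the vertex `β` lies in the `i`-th residue. -/
  residue : PosRoot n → Fin (n + 1) → Prop
  /-- `arrow α β`: there is an arrow `α → β`. -/
  arrow : PosRoot n → PosRoot n → Prop

/-- The combinatorial AR-quiver of a reduced word of `w_0`.  The colours of the arrows are omitted,
since in a simply laced type they are all equal to `1`. -/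
def arQuiver (n : ℕ) (w : Word n) : RootQuiver n where
  residue β i := ∃ k : Fin w.length, wordRoot n w k = β.1 ∧ w.get k = i
  arrow α β := ∃ k j : Fin w.length, wordRoot n w k = α.1 ∧ wordRoot n w j = β.1 ∧
    Adj n (w.get k) (w.get j) ∧ j < k ∧
    (∀ j' : Fin w.length, j < j' → j' < k → w.get j' ≠ w.get j) ∧
    (∀ k' : Fin w.length, j < k' → k' < k → w.get k' ≠ w.get k)

/-- The twisted AR-quivers: the combinatorial AR-quivers of the twisted adapted classes. -/
def twistedARQuivers (n : ℕ) : Set (RootQuiver n) :=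
  {Y | ∃ c ∈ twistedAdaptedClasses n, ∃ w ∈ c, Y = arQuiver n w}

end TwistedD

end

open TwistedD

noncomputable section

namespace TwistedD

open TwistedDynkinQuiver

variable {n : ℕ}

/-! ### Simple roots and coweights in coordinates -/

section Roots

/-! A twisted Dynkin quiver is a family of bits: one for each edge of the path and one for the fork,
called channels. A letter sends a prescribed signal to each channel that it touches. It is a sink
exactly when its signals agree with the stored bits, and reflecting at it flips those bits. Hence a
word is adapted iff on every channel its signals alternate, starting with the stored bit
(`adapted_iff`). Adjacent letters share a channel; non-adjacent letters on different vertices share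
none. Adaptedness is therefore invariant under commutation, and adapted words with the same number
of letters on every vertex are commutation equivalent (`Adapted.commEquiv`). Which letter counts
occur is decided edge by edge (`exists_adapted`).

Root theory enters through the element of a transversal adapted word. For `1 2 ⋯ n` the twisted
Coxeter element is a cyclic shift of coordinates with one sign, so its power of exponent `n + 1` is
`-1`. Reflecting at sinks conjugates this element and connects all quivers, so the same holds for
every quiver (`coxeterOf_pow`). Thus an adapted word with `n + 1` letters on every vertex represents
`-σ^(n+1) = w₀`, and it is reduced because its length is the number of positive roots. Conversely a
reduced adapted word cannot have more letters on a vertex. So `[Q]` consists exactly of the adapted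
words with `n + 1` letters on every vertex, a single commutation class (`mem_adaptedClass_iff`,
`adaptedClass_eq_commClass`).

Injectivity is obtained by recovering adapted words. The twisted Coxeter element determines the
sinks, and this persists under reflection (`eq_of_coxeterOf_eq`). Both the AR-quiver and the convex
order determine the order of the roots of adjacent consecutive letters, and that suffices to recover
`Q` (`eq_of_wordOrder`). For surjectivity, the reflection functors on classes correspond to
reflections of quivers (`twistedAdaptedClasses_eq`). -/

theorem dotProduct_simpleRoot_of_lt {i : Fin (n + 1)} (h : (i : ℕ) < n) (v : V n) :
    v ⬝ᵥ simpleRoot n i = v i - v ⟨i + 1, by omega⟩ := by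
  simp [simpleRoot, h, eps, dotProduct_sub]

theorem dotProduct_simpleRoot_last (v : V n) :
    v ⬝ᵥ simpleRoot n (Fin.last n) = v ⟨n - 1, by omega⟩ + v (Fin.last n) := by
  simp [simpleRoot, eps, dotProduct_add]

theorem simpleRoot_apply_of_lt {i : Fin (n + 1)} (h : (i : ℕ) < n) (a : Fin (n + 1)) :
    simpleRoot n i a = if (a : ℕ) = i then 1 else if (a : ℕ) = i + 1 then -1 else 0 := by
  simp only [simpleRoot, h, dif_pos, eps, Pi.sub_apply, Pi.single_apply, Fin.ext_iff]
  split_ifs <;> first | omega | simp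

theorem simpleRoot_last_apply (hn : 1 ≤ n) (a : Fin (n + 1)) :
    simpleRoot n (Fin.last n) a = if (a : ℕ) = n ∨ (a : ℕ) + 1 = n then 1 else 0 := by
  simp only [simpleRoot, Fin.val_last, lt_irrefl, dif_neg, not_false_eq_true, eps, Pi.add_apply,
    Pi.single_apply, Fin.ext_iff]
  split_ifs <;> first | omega | simp

theorem eq_last_of_not_lt {i : Fin (n + 1)} (h : ¬ (i : ℕ) < n) : i = Fin.last n := by
  ext; simp; omega

/-- The Cartan matrix. -/
theorem simpleRoot_dotProduct_simpleRoot (hn : 2 ≤ n) (i j : Fin (n + 1)) :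
    simpleRoot n i ⬝ᵥ simpleRoot n j =
      if i = j then 2 else
        if vertex n i + 1 = vertex n j ∨ vertex n j + 1 = vertex n i then -1 else 0 := by
  have key : ∀ x : ℝ, (i = j → x = 2) → (i ≠ j → (vertex n i + 1 = vertex n j ∨
      vertex n j + 1 = vertex n i) → x = -1) → (i ≠ j → ¬ (vertex n i + 1 = vertex n j ∨
      vertex n j + 1 = vertex n i) → x = 0) → x = if i = j then 2 else
        if vertex n i + 1 = vertex n j ∨ vertex n j + 1 = vertex n i then -1 else 0 := by
    intro x h1 h2 h3
    split_ifs with h h'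
    · exact h1 h
    · exact h2 h h'
    · exact h3 h h'
  apply key <;> clear key <;> by_cases hi : (i : ℕ) < n <;> by_cases hj : (j : ℕ) < n
  all_goals
    first
    | rw [dotProduct_simpleRoot_of_lt hj]
    | (obtain rfl := eq_last_of_not_lt hj; rw [dotProduct_simpleRoot_last])
    first
    | rw [simpleRoot_apply_of_lt hi, simpleRoot_apply_of_lt hi]
    | (obtain rfl := eq_last_of_not_lt hi
       rw [simpleRoot_last_apply (by omega), simpleRoot_last_apply (by omega)])
    simp only [ne_eq, Fin.ext_iff, vertex, Fin.val_last]
    intros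
    split_ifs <;> first | omega | (norm_num; done) | simp_all

theorem simpleRoot_dotProduct_self (hn : 2 ≤ n) (i : Fin (n + 1)) :
    simpleRoot n i ⬝ᵥ simpleRoot n i = 2 := by
  rw [simpleRoot_dotProduct_simpleRoot hn, if_pos rfl]

theorem adj_iff (hn : 2 ≤ n) (i j : Fin (n + 1)) :
    Adj n i j ↔ vertex n i + 1 = vertex n j ∨ vertex n j + 1 = vertex n i := by
  rw [Adj, simpleRoot_dotProduct_simpleRoot hn]
  split_ifs with h1 h2
  · subst h1; norm_num
  · simp [h2]
  · simp [h2]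

theorem adj_symm {i j : Fin (n + 1)} (h : Adj n i j) : Adj n j i := by
  rwa [Adj, dotProduct_comm]

theorem dotProduct_eq_zero_of_not_adj (hn : 2 ≤ n) {i j : Fin (n + 1)} (h : i ≠ j)
    (h' : ¬ Adj n i j) : simpleRoot n i ⬝ᵥ simpleRoot n j = 0 := by
  rw [adj_iff hn] at h'
  rw [simpleRoot_dotProduct_simpleRoot hn, if_neg h, if_neg h']

/-- A positive multiple of the fundamental coweight of the index `l`. -/
def coweight (n : ℕ) (l : Fin (n + 1)) : V n := fun a =>
  if (l : ℕ) < n - 1 then (if a ≤ l then 1 else 0)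
  else if (l : ℕ) = n - 1 then (if a = Fin.last n then -1 else 1) else 1

theorem coweight_dotProduct (hn : 2 ≤ n) {l k : Fin (n + 1)} (h : l ≠ k) :
    coweight n l ⬝ᵥ simpleRoot n k = 0 := by
  by_cases hk : (k : ℕ) < n
  · rw [dotProduct_simpleRoot_of_lt hk]
    rw [Ne, Fin.ext_iff] at h
    simp only [coweight, Fin.ext_iff, Fin.le_def, Fin.val_last]
    split_ifs <;> first | omega | norm_num
  · obtain rfl := eq_last_of_not_lt hk
    rw [dotProduct_simpleRoot_last]
    rw [Ne, Fin.ext_iff] at h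
    simp only [Fin.val_last] at h
    simp only [coweight, Fin.ext_iff, Fin.le_def, Fin.val_last]
    split_ifs <;> first | omega | norm_num

theorem coweight_dotProduct_self_pos (hn : 2 ≤ n) (l : Fin (n + 1)) :
    0 < coweight n l ⬝ᵥ simpleRoot n l := by
  by_cases hk : (l : ℕ) < n
  · rw [dotProduct_simpleRoot_of_lt hk]
    simp only [coweight, Fin.ext_iff, Fin.le_def, Fin.val_last]
    split_ifs <;> first | omega | norm_num
  · obtain rfl := eq_last_of_not_lt hk
    rw [dotProduct_simpleRoot_last]
    simp only [coweight, Fin.ext_iff, Fin.val_last]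
    split_ifs <;> first | omega | norm_num

theorem simpleRoot_injective (hn : 2 ≤ n) : Function.Injective (simpleRoot n) := by
  intro i j h
  by_contra hne
  have h1 := coweight_dotProduct_self_pos hn i
  rw [h, coweight_dotProduct hn hne] at h1
  exact lt_irrefl _ h1

/-! ### Simple reflections and products of words -/

theorem simpleRefl_apply (i : Fin (n + 1)) (v : V n) :
    simpleRefl n i v = v - (v ⬝ᵥ simpleRoot n i) • simpleRoot n i := rfl

theorem simpleRefl_dotProduct (hn : 2 ≤ n) (i : Fin (n + 1)) (v w : V n) :
    simpleRefl n i v ⬝ᵥ simpleRefl n i w = v ⬝ᵥ w := by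
  simp only [simpleRefl_apply, sub_dotProduct, dotProduct_sub, smul_dotProduct, dotProduct_smul,
    simpleRoot_dotProduct_self hn, smul_eq_mul, dotProduct_comm (simpleRoot n i) w]
  ring

theorem simpleRefl_simpleRoot_self (hn : 2 ≤ n) (i : Fin (n + 1)) :
    simpleRefl n i (simpleRoot n i) = -simpleRoot n i := by
  rw [simpleRefl_apply, simpleRoot_dotProduct_self hn, two_smul]; abel

theorem simpleRefl_mul_self (hn : 2 ≤ n) (i : Fin (n + 1)) :
    simpleRefl n i * simpleRefl n i = 1 := by
  refine LinearMap.ext fun v => ?_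
  simp only [Module.End.mul_apply, Module.End.one_apply]
  rw [simpleRefl_apply i v, map_sub, map_smul, simpleRefl_simpleRoot_self hn, simpleRefl_apply]
  simp

theorem simpleRefl_simpleRefl (hn : 2 ≤ n) (i : Fin (n + 1)) (v : V n) :
    simpleRefl n i (simpleRefl n i v) = v := by
  rw [← Module.End.mul_apply, simpleRefl_mul_self hn, Module.End.one_apply]

theorem simpleRefl_injective (hn : 2 ≤ n) (i : Fin (n + 1)) :
    Function.Injective (simpleRefl n i) :=
  Function.LeftInverse.injective (simpleRefl_simpleRefl hn i)

theorem simpleRefl_commute (i j : Fin (n + 1))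
    (h : simpleRoot n i ⬝ᵥ simpleRoot n j = 0) :
    simpleRefl n i * simpleRefl n j = simpleRefl n j * simpleRefl n i := by
  refine LinearMap.ext fun v => ?_
  have h' : simpleRoot n j ⬝ᵥ simpleRoot n i = 0 := by rwa [dotProduct_comm]
  simp only [Module.End.mul_apply, simpleRefl_apply, sub_dotProduct, smul_dotProduct, h, h',
    smul_zero, sub_zero]
  abel

theorem not_adj_of_commute (hn : 2 ≤ n) {i j : Fin (n + 1)}
    (h : simpleRefl n i * simpleRefl n j = simpleRefl n j * simpleRefl n i) : ¬ Adj n i j := by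
  intro ha
  have ha' := adj_symm ha
  rw [Adj] at ha ha'
  -- For adjacent indices `s_i s_j` sends `α_i` to `α_j`, while `s_j s_i` sends it to `-α_i - α_j`.
  -- Pairing with `α_j` gives `2` and `-1`.
  have h1 := congrArg (fun f => f (simpleRoot n i) ⬝ᵥ simpleRoot n j) h
  simp only [Module.End.mul_apply] at h1
  rw [simpleRefl_simpleRoot_self hn] at h1
  simp only [simpleRefl_apply, sub_dotProduct, smul_dotProduct, neg_dotProduct, ha, ha',
    simpleRoot_dotProduct_self hn, smul_eq_mul] at h1
  norm_num at h1

/-- Reflections of non-adjacent indices commute. -/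
theorem simpleRefl_commute_of_not_adj (hn : 2 ≤ n) {i j : Fin (n + 1)} (h : ¬ Adj n i j) :
    simpleRefl n i * simpleRefl n j = simpleRefl n j * simpleRefl n i := by
  by_cases hij : i = j
  · rw [hij]
  · exact simpleRefl_commute i j (dotProduct_eq_zero_of_not_adj hn hij h)

theorem simpleRefl_simpleRoot_of_not_adj (hn : 2 ≤ n) {i j : Fin (n + 1)} (hij : i ≠ j)
    (h : ¬ Adj n i j) : simpleRefl n i (simpleRoot n j) = simpleRoot n j := by
  rw [simpleRefl_apply, dotProduct_comm, dotProduct_eq_zero_of_not_adj hn hij h]; simp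

@[simp] theorem wordProd_nil : wordProd n [] = 1 := rfl

theorem wordProd_cons (i : Fin (n + 1)) (w : Word n) :
    wordProd n (i :: w) = simpleRefl n i * wordProd n w := by simp [wordProd]

theorem wordProd_append (u w : Word n) :
    wordProd n (u ++ w) = wordProd n u * wordProd n w := by simp [wordProd]

theorem wordProd_singleton (i : Fin (n + 1)) : wordProd n [i] = simpleRefl n i := by
  simp [wordProd]

theorem wordProd_cons_apply (i : Fin (n + 1)) (w : Word n) (v : V n) :
    wordProd n (i :: w) v = simpleRefl n i (wordProd n w v) := by simp [wordProd]

theorem wordProd_append_apply (u w : Word n) (v : V n) :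
    wordProd n (u ++ w) v = wordProd n u (wordProd n w v) := by simp [wordProd]

theorem wordProd_reverse_mul (hn : 2 ≤ n) (w : Word n) :
    wordProd n w.reverse * wordProd n w = 1 := by
  induction w with
  | nil => simp
  | cons i w ih =>
    rw [List.reverse_cons, wordProd_append, wordProd_singleton, wordProd_cons, mul_assoc,
      ← mul_assoc (simpleRefl n i), simpleRefl_mul_self hn, one_mul, ih]

theorem wordProd_mul_reverse (hn : 2 ≤ n) (w : Word n) :
    wordProd n w * wordProd n w.reverse = 1 := by
  have := wordProd_reverse_mul hn w.reverse
  rwa [List.reverse_reverse] at this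

theorem wordProd_injective (hn : 2 ≤ n) (w : Word n) : Function.Injective (wordProd n w) := by
  apply Function.LeftInverse.injective (g := wordProd n w.reverse)
  intro v
  rw [← Module.End.mul_apply, wordProd_reverse_mul hn, Module.End.one_apply]

theorem wordProd_dotProduct (hn : 2 ≤ n) (u : Word n) (v w : V n) :
    wordProd n u v ⬝ᵥ wordProd n u w = v ⬝ᵥ w := by
  induction u with
  | nil => simp
  | cons i u ih => rw [wordProd_cons_apply, wordProd_cons_apply, simpleRefl_dotProduct hn, ih]

/-- Conjugating a simple reflection to a simple reflection. -/
theorem simpleRefl_mul_wordProd (hn : 2 ≤ n) {u : Word n} {i j : Fin (n + 1)}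
    (h : wordProd n u (simpleRoot n j) = simpleRoot n i) :
    simpleRefl n i * wordProd n u = wordProd n u * simpleRefl n j := by
  refine LinearMap.ext fun v => ?_
  simp only [Module.End.mul_apply, simpleRefl_apply, map_sub, map_smul]
  rw [← h, wordProd_dotProduct hn]

/-- A word that avoids `l` does not change the coefficient of the simple root `l`. -/
theorem coweight_dotProduct_wordProd (hn : 2 ≤ n) {l : Fin (n + 1)} {u : Word n} (h : l ∉ u)
    (v : V n) : coweight n l ⬝ᵥ wordProd n u v = coweight n l ⬝ᵥ v := by
  induction u with
  | nil => simp
  | cons i u ih =>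
    rw [List.mem_cons, not_or] at h
    rw [wordProd_cons_apply, simpleRefl_apply, dotProduct_sub, dotProduct_smul,
      coweight_dotProduct hn h.1, smul_zero, sub_zero, ih h.2]

theorem wordProd_simpleRoot_of_not_adj (hn : 2 ≤ n) {i : Fin (n + 1)} {u : Word n}
    (h : ∀ l ∈ u, l ≠ i ∧ ¬ Adj n l i) : wordProd n u (simpleRoot n i) = simpleRoot n i := by
  induction u with
  | nil => simp
  | cons l u ih =>
    rw [wordProd_cons_apply, ih fun m hm => h m (List.mem_cons_of_mem _ hm)]
    have := h l List.mem_cons_self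
    exact simpleRefl_simpleRoot_of_not_adj hn this.1 this.2

/-! ### Roots and positivity -/

/-- The vectors with integral coordinates and squared length `2`. -/
def IsRoot (n : ℕ) (v : V n) : Prop := (∃ z : Fin (n + 1) → ℤ, v = fun a => (z a : ℝ)) ∧ v ⬝ᵥ v = 2

/-- The sum of the positive roots, up to a factor. -/
def rho (n : ℕ) : V n := fun a => ((n - a : ℤ) : ℝ)

theorem rho_dotProduct_simpleRoot (hn : 2 ≤ n) (i : Fin (n + 1)) :
    rho n ⬝ᵥ simpleRoot n i = 1 := by
  by_cases hi : (i : ℕ) < n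
  · rw [dotProduct_simpleRoot_of_lt hi]; simp [rho]
  · obtain rfl := eq_last_of_not_lt hi
    rw [dotProduct_simpleRoot_last]
    simp only [rho, Fin.val_last]
    push_cast [Nat.cast_sub (by omega : 1 ≤ n)]
    ring

theorem IsPosRoot.isRoot {v : V n} (h : IsPosRoot n v) : IsRoot n v := by
  obtain ⟨a, b, hab, h⟩ := h
  have e : ∀ c : Fin (n + 1), eps n c = fun d => (((Pi.single c 1 : Fin (n + 1) → ℤ) d : ℤ) : ℝ) := by
    intro c; ext d; simp only [eps, Pi.single_apply]; split_ifs <;> simp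
  refine ⟨?_, ?_⟩
  · rcases h with rfl | rfl
    · exact ⟨Pi.single a 1 - Pi.single b 1, by rw [e a, e b]; ext; simp⟩
    · exact ⟨Pi.single a 1 + Pi.single b 1, by rw [e a, e b]; ext; simp⟩
  · rcases h with rfl | rfl <;>
    simp [eps, dotProduct_sub, dotProduct_add, hab.ne, hab.ne'] <;>
    norm_num

/-- Pairing with `rho` is the height function; its sign separates positive from negative roots. -/
theorem IsPosRoot.rho_pos {v : V n} (h : IsPosRoot n v) : 1 ≤ rho n ⬝ᵥ v := by
  obtain ⟨a, b, hab, h⟩ := h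
  have h1 : (a : ℝ) + 1 ≤ b := by exact_mod_cast hab
  have h2 : (b : ℝ) ≤ n := by exact_mod_cast Nat.lt_succ_iff.mp b.2
  rcases h with rfl | rfl
  · simp [eps, dotProduct_sub, rho]; linarith
  · simp [eps, dotProduct_add, rho]; linarith

theorem isRoot_simpleRoot (hn : 2 ≤ n) (i : Fin (n + 1)) : IsRoot n (simpleRoot n i) := by
  refine ⟨?_, simpleRoot_dotProduct_self hn i⟩
  by_cases hi : (i : ℕ) < n
  · refine ⟨fun a => if (a : ℕ) = i then 1 else if (a : ℕ) = i + 1 then -1 else 0, ?_⟩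
    ext a; rw [simpleRoot_apply_of_lt hi]; push_cast; rfl
  · obtain rfl := eq_last_of_not_lt hi
    refine ⟨fun a => if (a : ℕ) = n ∨ (a : ℕ) + 1 = n then 1 else 0, ?_⟩
    ext a; rw [simpleRoot_last_apply (by omega)]; push_cast; rfl

theorem IsRoot.dotProduct_int {v w : V n} (hv : IsRoot n v) (hw : IsRoot n w) :
    ∃ m : ℤ, v ⬝ᵥ w = m := by
  obtain ⟨⟨z, rfl⟩, -⟩ := hv
  obtain ⟨⟨z', rfl⟩, -⟩ := hw
  exact ⟨∑ a, z a * z' a, by simp [dotProduct]⟩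

theorem IsRoot.simpleRefl (hn : 2 ≤ n) {v : V n} (hv : IsRoot n v) (i : Fin (n + 1)) :
    IsRoot n (simpleRefl n i v) := by
  obtain ⟨m, hm⟩ := hv.dotProduct_int (isRoot_simpleRoot hn i)
  refine ⟨?_, by rw [simpleRefl_dotProduct hn, hv.2]⟩
  obtain ⟨⟨z, rfl⟩, -⟩ := hv
  obtain ⟨⟨z', hz'⟩, -⟩ := isRoot_simpleRoot hn i
  refine ⟨z - m • z', ?_⟩
  rw [simpleRefl_apply, hm, hz']
  ext; simp

/-- Every root is positive or negative. -/
theorem IsRoot.pos_or_neg {v : V n} (hv : IsRoot n v) : IsPosRoot n v ∨ IsPosRoot n (-v) := by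
  obtain ⟨⟨z, rfl⟩, h⟩ := hv
  have h2 : ∑ a, z a * z a = 2 := by
    have : ((∑ a, z a * z a : ℤ) : ℝ) = 2 := by push_cast; simpa [dotProduct] using h
    exact_mod_cast this
  obtain ⟨a, ha⟩ : ∃ a, z a ≠ 0 := by
    by_contra! hc
    simp [hc] at h2
  -- Squares of integers summing to `2` leave exactly two nonzero coordinates, each `1` or `-1`. The
  -- sign at the smaller index decides whether the root is positive.
  have unit : ∀ x : ℤ, x ≠ 0 → x * x ≤ 2 → x = 1 ∨ x = -1 := by
    intro x hx hx2
    have h1 : x < 2 := by nlinarith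
    have h2 : -2 < x := by nlinarith
    omega
  have hle : z a * z a ≤ 2 := by
    rw [← h2]
    exact Finset.single_le_sum (f := fun a => z a * z a) (fun b _ => mul_self_nonneg (z b))
      (Finset.mem_univ a)
  have ha1 := unit _ ha hle
  have haa : z a * z a = 1 := by rcases ha1 with h | h <;> rw [h] <;> norm_num
  have h3 : ∑ b ∈ Finset.univ.erase a, z b * z b = 1 := by
    have := Finset.add_sum_erase Finset.univ (fun b => z b * z b) (Finset.mem_univ a)
    omega
  obtain ⟨b, hb, hb0⟩ : ∃ b ∈ Finset.univ.erase a, z b ≠ 0 := by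
    by_contra! hc
    rw [Finset.sum_eq_zero fun b hb => by rw [hc b hb, mul_zero]] at h3
    omega
  have hab : b ≠ a := (Finset.mem_erase.mp hb).1
  have hble : z b * z b ≤ 1 := by
    rw [← h3]
    exact Finset.single_le_sum (f := fun a => z a * z a) (fun b _ => mul_self_nonneg (z b)) hb
  have hb1 := unit _ hb0 (by omega)
  have hbb : z b * z b = 1 := by rcases hb1 with h | h <;> rw [h] <;> norm_num
  have hz : ∀ c, c ≠ a → c ≠ b → z c = 0 := by
    intro c hca hcb
    have h4 : ∑ c ∈ (Finset.univ.erase a).erase b, z c * z c = 0 := by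
      have := Finset.add_sum_erase (Finset.univ.erase a) (fun b => z b * z b) hb
      omega
    rw [Finset.sum_eq_zero_iff_of_nonneg (fun c _ => mul_self_nonneg (z c))] at h4
    exact mul_self_eq_zero.mp (h4 c (by simp [hca, hcb]))
  have hv : (fun c => (z c : ℝ)) = (z a : ℝ) • eps n a + (z b : ℝ) • eps n b := by
    ext c
    simp only [eps, Pi.add_apply, Pi.smul_apply, Pi.single_apply, smul_eq_mul]
    by_cases hca : c = a
    · subst hca; simp [hab.symm]
    · by_cases hcb : c = b
      · subst hcb; simp [hab]
      · simp [hz c hca hcb, hca, hcb]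
  rw [hv]
  rcases lt_or_gt_of_ne hab with hlt | hlt <;> rcases ha1 with h | h <;> rcases hb1 with h' | h' <;>
    rw [h, h']
  · exact Or.inl ⟨b, a, hlt, Or.inr (by push_cast; module)⟩
  · exact Or.inr ⟨b, a, hlt, Or.inl (by push_cast; module)⟩
  · exact Or.inl ⟨b, a, hlt, Or.inl (by push_cast; module)⟩
  · exact Or.inr ⟨b, a, hlt, Or.inr (by push_cast; module)⟩
  · exact Or.inl ⟨a, b, hlt, Or.inr (by push_cast; module)⟩
  · exact Or.inl ⟨a, b, hlt, Or.inl (by push_cast; module)⟩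
  · exact Or.inr ⟨a, b, hlt, Or.inl (by push_cast; module)⟩
  · exact Or.inr ⟨a, b, hlt, Or.inr (by push_cast; module)⟩

theorem IsPosRoot.not_neg {v : V n} (h : IsPosRoot n v) : ¬ IsPosRoot n (-v) := by
  intro h'
  have h1 := h.rho_pos
  have h2 := h'.rho_pos
  rw [dotProduct_neg] at h2
  linarith

theorem isPosRoot_simpleRoot (hn : 2 ≤ n) (i : Fin (n + 1)) : IsPosRoot n (simpleRoot n i) := by
  refine (isRoot_simpleRoot hn i).pos_or_neg.resolve_right fun h => ?_
  have := h.rho_pos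
  rw [dotProduct_neg, rho_dotProduct_simpleRoot hn] at this
  linarith

/-- A simple reflection permutes the positive roots other than its own simple root. -/
theorem IsPosRoot.simpleRefl (hn : 2 ≤ n) {v : V n} (h : IsPosRoot n v) {i : Fin (n + 1)}
    (hi : v ≠ simpleRoot n i) : IsPosRoot n (simpleRefl n i v) := by
  refine (h.isRoot.simpleRefl hn i).pos_or_neg.resolve_right fun h' => ?_
  have h1 := h.rho_pos
  have h2 := h'.rho_pos
  rw [dotProduct_neg, simpleRefl_apply, dotProduct_sub, dotProduct_smul,
    rho_dotProduct_simpleRoot hn, smul_eq_mul, mul_one] at h2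
  apply hi
  -- If the image were negative, heights would force `(v, α_i) ≥ 2`. Then `|v - α_i|² = 4 - 2 (v,
  -- α_i) ≤ 0`, so `v = α_i`.
  rw [← sub_eq_zero, ← dotProduct_self_eq_zero]
  have h3 : 0 ≤ (v - simpleRoot n i) ⬝ᵥ (v - simpleRoot n i) :=
    Finset.sum_nonneg fun a _ => mul_self_nonneg _
  have h4 : (v - simpleRoot n i) ⬝ᵥ (v - simpleRoot n i) = 4 - 2 * (v ⬝ᵥ simpleRoot n i) := by
    rw [sub_dotProduct, dotProduct_sub, dotProduct_sub, h.isRoot.2, simpleRoot_dotProduct_self hn,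
      dotProduct_comm (simpleRoot n i)]
    ring
  linarith

/-! ### Roots of a word, inversions and reducedness -/

/-- The list of the roots `s_{i_1} ⋯ s_{i_{k-1}} (α_{i_k})` of a word. -/
def rootsOf (n : ℕ) : Word n → List (V n)
  | [] => []
  | i :: w => simpleRoot n i :: (rootsOf n w).map (simpleRefl n i)

@[simp] theorem length_rootsOf (w : Word n) : (rootsOf n w).length = w.length := by
  induction w with
  | nil => rfl
  | cons i w ih => simp [rootsOf, ih]

theorem rootsOf_append (u w : Word n) :
    rootsOf n (u ++ w) = rootsOf n u ++ (rootsOf n w).map (wordProd n u) := by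
  induction u with
  | nil => exact (List.map_id _).symm
  | cons i u ih => simp [rootsOf, ih, wordProd_cons_apply]

theorem wordRoot_eq (w : Word n) (k : Fin w.length) :
    wordRoot n w k = (rootsOf n w)[(k : ℕ)]'(by simp) := by
  induction w with
  | nil => exact k.elim0
  | cons i w ih =>
    refine Fin.cases ?_ (fun k => ?_) k
    · simp [wordRoot, rootsOf]
    · have := ih k
      simp only [wordRoot, List.get_eq_getElem] at this
      simp [wordRoot, rootsOf, wordProd_cons_apply, this]

theorem mem_rootsOf {w : Word n} {v : V n} :
    v ∈ rootsOf n w ↔ ∃ a j b, w = a ++ j :: b ∧ wordProd n a (simpleRoot n j) = v := by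
  induction w generalizing v with
  | nil => simp [rootsOf]
  | cons i w ih =>
    rw [rootsOf, List.mem_cons, List.mem_map]
    constructor
    · rintro (rfl | ⟨v, hv, rfl⟩)
      · exact ⟨[], i, w, rfl, rfl⟩
      · obtain ⟨a, j, b, rfl, rfl⟩ := ih.mp hv
        exact ⟨i :: a, j, b, rfl, by rw [wordProd_cons_apply]⟩
    · rintro ⟨a, j, b, h, rfl⟩
      cases a with
      | nil => simp at h; obtain ⟨rfl, rfl⟩ := h; left; rfl
      | cons k a =>
        simp at h
        obtain ⟨rfl, rfl⟩ := h
        exact Or.inr ⟨_, ih.mpr ⟨a, j, b, rfl, rfl⟩, by rw [wordProd_cons_apply]⟩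

/-- Every positive root made negative by the inverse of a word is a root of the word. -/
theorem mem_rootsOf_of_inversion (hn : 2 ≤ n) {w : Word n} {v : V n} (hv : IsPosRoot n v)
    (h : ¬ IsPosRoot n (wordProd n w.reverse v)) : v ∈ rootsOf n w := by
  induction w generalizing v with
  | nil => simp at h; exact absurd hv h
  | cons i w ih =>
    rw [rootsOf, List.mem_cons]
    by_cases hi : v = simpleRoot n i
    · exact Or.inl hi
    · right
      rw [List.reverse_cons, wordProd_append_apply, wordProd_singleton] at h
      exact List.mem_map.mpr ⟨_, ih (hv.simpleRefl hn hi) h, simpleRefl_simpleRefl hn i v⟩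

theorem IsReduced.of_append_right {u w : Word n} (h : IsReduced n (u ++ w)) : IsReduced n w := by
  intro v hv
  have := h (u ++ v) (by rw [wordProd_append, wordProd_append, hv])
  simpa using this

theorem IsReduced.of_append_left {u w : Word n} (h : IsReduced n (u ++ w)) : IsReduced n u := by
  intro v hv
  have := h (v ++ w) (by rw [wordProd_append, wordProd_append, hv])
  simpa using this

/-- The roots of a reduced word are positive. -/
theorem IsReduced.isPosRoot (hn : 2 ≤ n) {w : Word n} (h : IsReduced n w) {v : V n}
    (hv : v ∈ rootsOf n w) : IsPosRoot n v := by
  induction w generalizing v with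
  | nil => simp [rootsOf] at hv
  | cons i w ih =>
    rw [rootsOf, List.mem_cons, List.mem_map] at hv
    rcases hv with rfl | ⟨v, hv, rfl⟩
    · exact isPosRoot_simpleRoot hn i
    · have hvp := ih (IsReduced.of_append_right (u := [i]) h) hv
      refine hvp.simpleRefl hn ?_
      rintro rfl
      -- Deletion: if `a (α_j) = α_i`, then `s_i a = a s_j`, so `i a j b` and `a b` represent the
      -- same element.
      obtain ⟨a, j, b, rfl, hr⟩ := mem_rootsOf.mp hv
      have := h (a ++ b) ?_
      · simp at this
      · rw [wordProd_append, wordProd_cons, wordProd_append, wordProd_cons, ← mul_assoc,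
          simpleRefl_mul_wordProd hn hr, mul_assoc, ← mul_assoc (simpleRefl n j),
          simpleRefl_mul_self hn, one_mul]

/-- The roots of a reduced word are distinct. -/
theorem IsReduced.nodup_rootsOf (hn : 2 ≤ n) {w : Word n} (h : IsReduced n w) :
    (rootsOf n w).Nodup := by
  induction w with
  | nil => simp [rootsOf]
  | cons i w ih =>
    have hw : IsReduced n w := IsReduced.of_append_right (u := [i]) h
    rw [rootsOf, List.nodup_cons]
    refine ⟨fun hm => ?_, (ih hw).map (simpleRefl_injective hn i)⟩
    obtain ⟨v, hv, hvi⟩ := List.mem_map.mp hm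
    have h1 : v = -simpleRoot n i := by
      rw [← simpleRefl_simpleRoot_self hn, ← hvi, simpleRefl_simpleRefl hn]
    have h2 := hw.isPosRoot hn hv
    rw [h1] at h2
    exact (isPosRoot_simpleRoot hn i).not_neg h2

theorem IsReduced.isPosRoot_wordProd (hn : 2 ≤ n) {u t : Word n} {i : Fin (n + 1)}
    (h : IsReduced n (u ++ i :: t)) : IsPosRoot n (wordProd n u (simpleRoot n i)) :=
  h.isPosRoot hn (mem_rootsOf.mpr ⟨u, i, t, rfl, rfl⟩)

end Roots

/-! ### Quivers as bits on channels, letters as signals -/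

section Words

theorem vertex_lt (hn : 2 ≤ n) (i : Fin (n + 1)) : vertex n i < n := by
  simp only [vertex]; omega

theorem vertex_vee (i : Fin (n + 1)) : vertex n (vee n i) = vertex n i := by
  simp only [vee, vertex, Equiv.swap_apply_def]
  split_ifs with h1 h2 <;> simp_all

/-- The letters carried by the same vertex of the path are exchanged by `∨`. -/
theorem eq_or_eq_vee_iff (hn : 2 ≤ n) (i j : Fin (n + 1)) :
    j = i ∨ j = vee n i ↔ vertex n j = vertex n i := by
  constructor
  · rintro (rfl | rfl)
    · rfl
    · exact vertex_vee i
  · intro h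
    simp only [vee, Equiv.swap_apply_def, vertex] at *
    split_ifs <;> simp_all [Fin.ext_iff] <;> omega

/-- The Boolean recording how a letter acts on a channel: `some k` is the edge `k` of the path, and
`none` is the fork.  The value is `none` if the letter does not touch the channel. -/
def signal (n : ℕ) : Option (Fin (n - 1)) → Fin (n + 1) → Option Bool
  | some k, i =>
    if vertex n i = k then some false else if vertex n i = k + 1 then some true else none
  | none, i => if (i : ℕ) = n - 1 then some false else if (i : ℕ) = n then some true else none

/-- The state of a twisted Dynkin quiver on each channel. -/
def state (Q : TwistedDynkinQuiver n) : Option (Fin (n - 1)) → Bool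
  | some k => Q.toRight k
  | none => Q.swapped

theorem state_ext {Q Q' : TwistedDynkinQuiver n} (h : ∀ c, state Q c = state Q' c) : Q = Q' :=
  TwistedDynkinQuiver.ext (h none) (funext fun k => h (some k))

/-- The quiver with a given state. -/
def ofState (f : Option (Fin (n - 1)) → Bool) : TwistedDynkinQuiver n := ⟨f none, fun k => f (some k)⟩

@[simp] theorem state_ofState (f : Option (Fin (n - 1)) → Bool) (c : Option (Fin (n - 1))) :
    state (ofState f) c = f c := by cases c <;> rfl

/-- Visibility is the condition on the fork channel; the conditions on arrows are those on the edge
channels. All three then have the same form. -/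
theorem isSink_iff (hn : 2 ≤ n) (Q : TwistedDynkinQuiver n) (i : Fin (n + 1)) :
    Q.IsSink i ↔ ∀ c b, signal n c i = some b → state Q c = b := by
  constructor
  · rintro ⟨h1, h2, h3⟩ c b hs
    cases c with
    | none =>
      simp only [signal] at hs
      rcases h1 with h | ⟨h, hq⟩ | ⟨h, hq⟩
      · rw [if_neg (by omega), if_neg (by omega)] at hs; simp at hs
      · rw [if_pos h] at hs; simp at hs; rw [hs]; exact hq
      · rw [if_neg (by omega), if_pos h] at hs; simp at hs; rw [hs]; exact hq
    | some k =>
      simp only [signal] at hs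
      split_ifs at hs with h h'
      · simp at hs; rw [hs]; exact h2 k h.symm
      · simp at hs; rw [hs]; exact h3 k h'.symm
  · intro h
    refine ⟨?_, fun k hk => ?_, fun k hk => ?_⟩
    · rcases (by omega : (i : ℕ) < n - 1 ∨ (i : ℕ) = n - 1 ∨ (i : ℕ) = n) with hi | hi | hi
      · exact Or.inl hi
      · exact Or.inr (Or.inl ⟨hi, h none false (by simp [signal, hi])⟩)
      · refine Or.inr (Or.inr ⟨hi, h none true ?_⟩)
        simp only [signal]
        rw [if_neg (by omega), if_pos hi]
    · exact h (some k) false (by simp [signal, hk])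
    · exact h (some k) true (by simp [signal, ← hk])

theorem isSome_signal_fork (i : Fin (n + 1)) :
    (signal n none i).isSome = decide (vertex n i = n - 1) := by
  simp only [signal, vertex]
  split_ifs <;> simp <;> omega

theorem state_reflect (hn : 2 ≤ n) {Q : TwistedDynkinQuiver n} {i : Fin (n + 1)}
    (h : Q.IsSink i) (c : Option (Fin (n - 1))) :
    state (Q.reflect i) c = xor (state Q c) (signal n c i).isSome := by
  rw [reflect, if_pos (Or.inl h)]
  cases c with
  | none =>
    rw [isSome_signal_fork]
    by_cases hv : vertex n i = n - 1 <;> simp [state, hv]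
  | some k =>
    simp only [state, signal]
    split_ifs <;> first | omega | simp

theorem vertex_eq_of_signal_eq {c : Option (Fin (n - 1))} {i j : Fin (n + 1)} {b : Bool}
    (hi : signal n c i = some b) (hj : signal n c j = some b) : vertex n i = vertex n j := by
  cases c <;> simp only [signal] at hi hj <;> split_ifs at hi hj <;> first | omega | simp_all [vertex]

/-- The channel is the edge joining the two vertices. Alternation on it controls the relative order
of adjacent letters. -/
theorem exists_signal_of_adj (hn : 2 ≤ n) {i j : Fin (n + 1)} (h : Adj n i j) :
    ∃ c b, signal n c i = some b ∧ signal n c j = some (!b) := by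
  rw [adj_iff hn] at h
  have := vertex_lt hn i
  have := vertex_lt hn j
  rcases h with h | h
  · refine ⟨some ⟨vertex n i, by omega⟩, false, by simp [signal], ?_⟩
    simp [signal, ← h]
  · refine ⟨some ⟨vertex n j, by omega⟩, true, ?_, by simp [signal]⟩
    simp [signal, ← h]

theorem signal_eq_none_of_not_adj (hn : 2 ≤ n) {i j : Fin (n + 1)} (h : ¬ Adj n i j)
    (hv : vertex n i ≠ vertex n j) {c : Option (Fin (n - 1))} {b : Bool}
    (hi : signal n c i = some b) : signal n c j = none := by
  rw [adj_iff hn] at h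
  cases c with
  | none =>
    simp only [signal, vertex] at *
    split_ifs at * <;> first | omega | rfl
  | some k =>
    simp only [signal] at *
    split_ifs at * <;> first | omega | rfl

/-- Since `n ≥ 2`, every vertex lies on an edge, and an edge sees only the vertex of a letter. Hence
the two fork letters, although they commute, are never consecutive in an adapted word. -/
theorem exists_signal_of_vertex_eq (hn : 2 ≤ n) {i j : Fin (n + 1)} (h : vertex n i = vertex n j) :
    ∃ c b, signal n c i = some b ∧ signal n c j = some b := by
  have := vertex_lt hn i
  by_cases h0 : vertex n i = 0
  · exact ⟨some ⟨0, by omega⟩, false, by simp [signal, h0], by simp [signal, ← h, h0]⟩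
  · refine ⟨some ⟨vertex n i - 1, by omega⟩, true, ?_, ?_⟩
    · simp only [signal]; rw [if_neg (by omega), if_pos (by omega)]
    · simp only [signal]; rw [if_neg (by omega), if_pos (by omega)]

theorem eq_of_signal_none (hn : 2 ≤ n) {i j : Fin (n + 1)} (h : vertex n i = vertex n j)
    (h' : signal n none i = signal n none j) : i = j := by
  ext
  simp only [signal, vertex] at *
  split_ifs at * <;> first | omega | simp_all

/-! ### Adaptedness as alternation of signals -/

/-- The Booleans of the list alternate, starting from the given value. -/
def Alternating : Bool → List Bool → Prop
  | _, [] => True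
  | b, c :: l => c = b ∧ Alternating (!b) l

theorem Alternating.append_right {b : Bool} {l l' : List Bool} (h : Alternating b (l ++ l')) :
    ∃ b', Alternating b' l' := by
  induction l generalizing b with
  | nil => exact ⟨b, h⟩
  | cons c l ih => exact ih h.2

/-- A sink agrees with the bits on its channels and its reflection flips precisely those, so the
next signal on each of them must be the opposite one. The channels evolve independently of each
other. -/
theorem adapted_iff (hn : 2 ≤ n) (Q : TwistedDynkinQuiver n) (w : Word n) :
    Q.Adapted w ↔ ∀ c, Alternating (state Q c) (w.filterMap (signal n c)) := by
  induction w generalizing Q with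
  | nil => simp [Adapted, Alternating]
  | cons i w ih =>
    rw [Adapted, ih]
    constructor
    · rintro ⟨hs, h⟩ c
      have h1 := h c
      rw [state_reflect hn hs] at h1
      rw [List.filterMap_cons]
      rcases hc : signal n c i with - | b
      · simpa [hc] using h1
      · have := (isSink_iff hn Q i).mp hs c b hc
        simp only [hc, Option.isSome_some, Bool.xor_true] at h1
        exact ⟨this.symm, h1⟩
    · intro h
      have hs : Q.IsSink i := by
        rw [isSink_iff hn]
        intro c b hc
        have := h c
        rw [List.filterMap_cons, hc] at this
        exact this.1.symm
      refine ⟨hs, fun c => ?_⟩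
      have h1 := h c
      rw [state_reflect hn hs]
      rw [List.filterMap_cons] at h1
      rcases hc : signal n c i with - | b
      · simpa [hc] using h1
      · rw [hc] at h1
        simpa using h1.2

/-- The quiver `i_l ⋯ i_2 i_1 Q`. -/
def after (Q : TwistedDynkinQuiver n) (w : Word n) : TwistedDynkinQuiver n := w.foldl reflect Q

theorem after_cons (Q : TwistedDynkinQuiver n) (i : Fin (n + 1)) (w : Word n) :
    after Q (i :: w) = after (Q.reflect i) w := rfl

theorem after_append (Q : TwistedDynkinQuiver n) (u w : Word n) :
    after Q (u ++ w) = after (after Q u) w := by simp [after]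

theorem adapted_append (Q : TwistedDynkinQuiver n) (u w : Word n) :
    Q.Adapted (u ++ w) ↔ Q.Adapted u ∧ (after Q u).Adapted w := by
  induction u generalizing Q with
  | nil => simp [Adapted, after]
  | cons i u ih => rw [List.cons_append, Adapted, Adapted, ih, after_cons, and_assoc]

/-! ### Counting letters on the vertices -/

/-- The number of letters of a word on a given vertex of the path. -/
def vcount (n v : ℕ) (w : Word n) : ℕ := w.countP fun j => decide (vertex n j = v)

@[simp] theorem vcount_nil (v : ℕ) : vcount n v [] = 0 := rfl

theorem vcount_cons (v : ℕ) (i : Fin (n + 1)) (w : Word n) :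
    vcount n v (i :: w) = vcount n v w + if vertex n i = v then 1 else 0 := by
  simp [vcount, List.countP_cons]

theorem vcount_append (v : ℕ) (u w : Word n) :
    vcount n v (u ++ w) = vcount n v u + vcount n v w := by simp [vcount]

theorem vcount_pos_iff {v : ℕ} {w : Word n} : 0 < vcount n v w ↔ ∃ j ∈ w, vertex n j = v := by
  simp [vcount, List.countP_pos_iff]

theorem isTransversal_iff (hn : 2 ≤ n) (w : Word n) :
    IsTransversal n w ↔ ∀ v < n, vcount n v w = 1 := by
  have key : ∀ i : Fin (n + 1), w.countP (fun j => decide (j = i ∨ j = vee n i)) =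
      vcount n (vertex n i) w := by
    intro i
    simp only [vcount, eq_or_eq_vee_iff hn]
  constructor
  · intro h v hv
    have := h ⟨v, by omega⟩
    rw [key] at this
    rwa [show vertex n ⟨v, by omega⟩ = v by simp only [vertex]; omega] at this
  · intro h i
    rw [key]
    exact h _ (vertex_lt hn i)

theorem length_eq_sum_vcount (hn : 2 ≤ n) (w : Word n) :
    w.length = ∑ v ∈ Finset.range n, vcount n v w := by
  induction w with
  | nil => simp
  | cons i w ih =>
    simp only [vcount_cons, Finset.sum_add_distrib, List.length_cons, ih]
    simp [vertex_lt hn i]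

/-- The numbers of letters on the ends of an edge determine how the edge changes. -/
theorem vcount_toRight (hn : 2 ≤ n) {Q : TwistedDynkinQuiver n} {w : Word n} (h : Q.Adapted w)
    (k : Fin (n - 1)) : vcount n (k + 1) w + ((after Q w).toRight k).toNat =
      vcount n k w + (Q.toRight k).toNat := by
  induction w generalizing Q with
  | nil => simp [after]
  | cons i w ih =>
    have h1 := ih h.2
    have h2 := state_reflect hn h.1 (some k)
    have h3 := (isSink_iff hn Q i).mp h.1 (some k)
    rw [after_cons, vcount_cons, vcount_cons]
    simp only [state, signal] at h2 h3
    rw [h2] at h1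
    split_ifs at * <;> first | omega | simp_all <;> omega

theorem swapped_after (hn : 2 ≤ n) {Q : TwistedDynkinQuiver n} {w : Word n} (h : Q.Adapted w) :
    (after Q w).swapped = xor Q.swapped (vcount n (n - 1) w).bodd := by
  induction w generalizing Q with
  | nil => simp [after]
  | cons i w ih =>
    have h2 := state_reflect hn h.1 none
    rw [isSome_signal_fork] at h2
    simp only [state] at h2
    rw [after_cons, ih h.2, h2, vcount_cons]
    by_cases hv : vertex n i = n - 1 <;> simp [hv]

theorem Alternating.head_eq {b x : Bool} {l : List Bool} (h : Alternating b (x :: l)) : b = x :=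
  h.1.symm

/-- A prescribed number of letters on every vertex is realised by an adapted word as soon as the
numbers at the ends of every edge are compatible with its orientation. -/
theorem exists_adapted (hn : 2 ≤ n) (Q : TwistedDynkinQuiver n) (c : ℕ → ℕ)
    (h : ∀ k : Fin (n - 1), c (k + 1) = c k + (Q.toRight k).toNat ∨
      c (k + 1) + 1 = c k + (Q.toRight k).toNat) :
    ∃ w, Q.Adapted w ∧ ∀ v < n, vcount n v w = c v := by
  induction hN : ∑ v ∈ Finset.range n, c v generalizing Q c with
  | zero =>
    rw [Finset.sum_eq_zero_iff] at hN
    exact ⟨[], trivial, fun v hv => by rw [hN v (Finset.mem_range.mpr hv)]; rfl⟩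
  | succ N ih =>
    have hex : ∃ v, v < n ∧ 0 < c v := by
      by_contra! hc
      rw [Finset.sum_eq_zero fun v hv => by
        have := hc v (Finset.mem_range.mp hv); omega] at hN
      omega
    -- From a vertex with positive demand and no arrow leaving it to the left, follow arrows to the
    -- right until none leaves. An arrow `v → v + 1` forces `c (v + 1) ≥ c v`, so the demand stays
    -- positive, and the walk ends at a sink vertex.
    have walk : ∀ m v, n - 1 - v = m → v < n → 0 < c v →
        (∀ k : Fin (n - 1), (k : ℕ) + 1 = v → Q.toRight k = true) →
        ∃ v, v < n ∧ 0 < c v ∧ (∀ k : Fin (n - 1), (k : ℕ) + 1 = v → Q.toRight k = true) ∧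
          (∀ k : Fin (n - 1), (k : ℕ) = v → Q.toRight k = false) := by
      intro m
      induction m with
      | zero =>
        intro v hm hv hc hl
        exact ⟨v, hv, hc, hl, fun k hk => by have := k.2; omega⟩
      | succ m ihm =>
        intro v hm hv hc hl
        by_cases hr : Q.toRight ⟨v, by omega⟩ = true
        · refine ihm (v + 1) (by omega) (by omega) ?_ ?_
          · have := h ⟨v, by omega⟩
            rw [hr] at this
            simp at this
            omega
          · intro k hk
            rw [← hr]; congr 1; ext; simp at hk; exact hk
        · refine ⟨v, hv, hc, hl, fun k hk => ?_⟩
          have : k = ⟨v, by omega⟩ := by ext; exact hk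
          rw [this]; simpa using hr
    obtain ⟨v, hv, hcv, hl, hr⟩ : ∃ v, v < n ∧ 0 < c v ∧
        (∀ k : Fin (n - 1), (k : ℕ) + 1 = v → Q.toRight k = true) ∧
          (∀ k : Fin (n - 1), (k : ℕ) = v → Q.toRight k = false) := by
      classical
      -- Start at the smallest vertex with positive demand. Its left neighbour has demand `0`, which
      -- by compatibility forces the edge between them to point to the right.
      refine walk _ (Nat.find hex) rfl (Nat.find_spec hex).1 (Nat.find_spec hex).2 fun k hk => ?_
      have h1 := Nat.find_min hex (m := k) (by omega)
      have h2 := h k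
      have h3 := (Nat.find_spec hex).2
      rw [← hk] at h3
      have h4 : c k = 0 := by
        by_contra h5
        exact h1 ⟨by have := k.2; omega, by omega⟩
      by_contra h5
      simp only [Bool.not_eq_true] at h5
      rw [h5] at h2
      simp at h2
      omega
    obtain ⟨i, hi, hvis⟩ : ∃ i : Fin (n + 1), vertex n i = v ∧ Q.IsVisible i := by
      by_cases h1 : v < n - 1
      · exact ⟨⟨v, by omega⟩, by simp only [vertex]; omega, Or.inl h1⟩
      · cases hs : Q.swapped
        · exact ⟨⟨n - 1, by omega⟩, by simp only [vertex]; omega, Or.inr (Or.inl ⟨rfl, hs⟩)⟩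
        · exact ⟨⟨n, by omega⟩, by simp only [vertex]; omega, Or.inr (Or.inr ⟨rfl, hs⟩)⟩
    have hsink : Q.IsSink i := ⟨hvis, by rwa [hi], by rwa [hi]⟩
    -- Using the sink once lowers its demand by one and reverses its edges, which preserves
    -- compatibility.
    obtain ⟨w, hw, hcw⟩ := ih (Q.reflect i) (Function.update c v (c v - 1)) (by
      intro k
      have h2 := state_reflect hn hsink (some k)
      simp only [state, signal, hi] at h2
      have h1 := h k
      rw [h2]
      by_cases hk : v = k
      · have := hr k hk.symm
        rw [this] at h1 ⊢
        subst hk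
        simp at h1 ⊢
        omega
      · by_cases hk' : v = k + 1
        · have := hl k hk'.symm
          rw [this] at h1 ⊢
          subst hk'
          simp at h1 ⊢
          omega
        · rw [if_neg hk, if_neg hk', Function.update_of_ne (by omega),
            Function.update_of_ne (by omega)]
          simpa using h1) (by
      rw [Finset.sum_update_of_mem (Finset.mem_range.mpr hv)]
      rw [← Finset.add_sum_erase _ _ (Finset.mem_range.mpr hv), ← Finset.sdiff_singleton_eq_erase]
        at hN
      omega)
    refine ⟨i :: w, ⟨hsink, hw⟩, fun u hu => ?_⟩
    rw [vcount_cons, hcw u hu, hi]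
    by_cases huv : v = u
    · subst huv; simp; omega
    · simp [huv, Function.update_of_ne (Ne.symm huv)]

theorem exists_adapted_const (hn : 2 ≤ n) (Q : TwistedDynkinQuiver n) (m : ℕ) :
    ∃ w, Q.Adapted w ∧ ∀ v < n, vcount n v w = m := by
  refine exists_adapted hn Q (fun _ => m) fun k => ?_
  cases Q.toRight k <;> simp

/-- Adapted words with at most `m` letters on every vertex can be completed. -/
theorem exists_completion (hn : 2 ≤ n) {Q : TwistedDynkinQuiver n} {u : Word n} (hu : Q.Adapted u)
    (m : ℕ) (h : ∀ v < n, vcount n v u ≤ m) :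
    ∃ t, Q.Adapted (u ++ t) ∧ ∀ v < n, vcount n v (u ++ t) = m := by
  -- By `vcount_toRight` the remaining demands are compatible with the edges of `after Q u`; the
  -- bound `h` makes the truncated subtractions exact.
  obtain ⟨t, ht, hc⟩ := exists_adapted hn (after Q u) (fun v => m - vcount n v u) fun k => by
    have h1 := vcount_toRight hn hu k
    have h2 := h k (by have := k.2; omega)
    have h3 := h (k + 1) (by have := k.2; omega)
    have h4 := Bool.toNat_le (Q.toRight k)
    have h5 := Bool.toNat_le ((after Q u).toRight k)
    omega
  refine ⟨t, (adapted_append _ _ _).mpr ⟨hu, ht⟩, fun v hv => ?_⟩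
  rw [vcount_append, hc v hv]
  have := h v hv
  omega

/-! ### Commutation classes of adapted words -/

/-- Commutation equivalence of words. -/
abbrev CommEquiv (n : ℕ) : Word n → Word n → Prop := Relation.EqvGen (CommStep n)

theorem CommStep.cons {u v : Word n} (h : CommStep n u v) (i : Fin (n + 1)) :
    CommStep n (i :: u) (i :: v) := by
  obtain ⟨a, b, j, k, hc, rfl, rfl⟩ := h
  exact ⟨i :: a, b, j, k, hc, rfl, rfl⟩

theorem CommEquiv.cons {u v : Word n} (h : CommEquiv n u v) (i : Fin (n + 1)) :
    CommEquiv n (i :: u) (i :: v) := by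
  induction h with
  | rel _ _ h => exact .rel _ _ (h.cons i)
  | refl => exact .refl _
  | symm _ _ _ ih => exact .symm _ _ ih
  | trans _ _ _ _ _ ih ih' => exact .trans _ _ _ ih ih'

theorem commEquiv_move (hn : 2 ≤ n) {a : Word n} {i : Fin (n + 1)} (b : Word n)
    (h : ∀ l ∈ a, ¬ Adj n l i) : CommEquiv n (a ++ i :: b) (i :: (a ++ b)) := by
  induction a with
  | nil => exact .refl _
  | cons l a ih =>
    refine .trans _ (l :: i :: (a ++ b)) _ ?_ ?_
    · exact CommEquiv.cons (ih fun m hm => h m (List.mem_cons_of_mem _ hm)) l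
    · exact .rel _ _ ⟨[], a ++ b, l, i,
        simpleRefl_commute_of_not_adj hn (h l List.mem_cons_self), rfl, rfl⟩

theorem exists_first {α : Type*} {p : α → Prop} {l : List α} (h : ∃ x ∈ l, p x) :
    ∃ a x b, l = a ++ x :: b ∧ p x ∧ ∀ y ∈ a, ¬ p y := by
  induction l with
  | nil => simp at h
  | cons y l ih =>
    by_cases hy : p y
    · exact ⟨[], y, l, rfl, hy, by simp⟩
    · obtain ⟨x, hx, hpx⟩ := h
      obtain ⟨a, x, b, rfl, hx, ha⟩ := ih ⟨x, by
        rcases List.mem_cons.mp hx with rfl | hx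
        · exact absurd hpx hy
        · exact hx, hpx⟩
      refine ⟨y :: a, x, b, rfl, hx, ?_⟩
      intro z hz
      rcases List.mem_cons.mp hz with rfl | hz
      · exact hy
      · exact ha z hz

/-- A sink whose vertex occurs in an adapted word can be pulled to the front. -/
theorem Adapted.pull (hn : 2 ≤ n) {Q : TwistedDynkinQuiver n} {w : Word n} (h : Q.Adapted w)
    {i : Fin (n + 1)} (hi : Q.IsSink i) (hc : 0 < vcount n (vertex n i) w) :
    ∃ a b, w = a ++ i :: b ∧ (∀ l ∈ a, vertex n l ≠ vertex n i ∧ ¬ Adj n l i) ∧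
      Q.Adapted (i :: (a ++ b)) := by
  obtain ⟨a, j, b, rfl, hj, ha⟩ := exists_first (vcount_pos_iff.mp hc)
  rw [adapted_iff hn] at h
  rw [isSink_iff hn] at hi
  -- On a channel of `i`, the first signal from `a` would have to equal the stored bit, which is the
  -- signal of `i`. Only letters on the vertex of `i` send that signal, and `a` contains none.
  have quiet : ∀ c x, signal n c i = some x → a.filterMap (signal n c) = [] := by
    intro c x hx
    rcases hl : a.filterMap (signal n c) with - | ⟨y, l⟩
    · rfl
    · have h1 := h c
      rw [List.filterMap_append, hl] at h1
      have h2 : y = x := by rw [h1.1, hi c x hx]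
      have h3 : y ∈ a.filterMap (signal n c) := by rw [hl]; exact List.mem_cons_self
      obtain ⟨m, hm, hmy⟩ := List.mem_filterMap.mp h3
      exact absurd (vertex_eq_of_signal_eq hmy (h2 ▸ hx)) (ha m hm)
  -- The edges only show that `j` and `i` lie on the same vertex; the fork channel decides between
  -- the two letters there.
  have hij : j = i := by
    refine eq_of_signal_none hn hj ?_
    rcases hx : signal n none i with - | x
    · simp only [signal, vertex] at *
      split_ifs at * <;> omega
    · have h1 := h none
      rw [List.filterMap_append, quiet _ x hx, List.filterMap_cons] at h1
      rcases hy : signal n none j with - | y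
      · simp only [signal, vertex] at *
        split_ifs at * <;> omega
      · rw [hy] at h1
        rw [← hi none x hx]
        exact congrArg some h1.1
  subst hij
  refine ⟨a, b, rfl, fun l hl => ⟨ha l hl, fun hadj => ?_⟩, ?_⟩
  · obtain ⟨c, x, hx, hx'⟩ := exists_signal_of_adj hn (adj_symm hadj)
    have := quiet c x hx
    rw [List.filterMap_eq_nil_iff] at this
    rw [this l hl] at hx'
    simp at hx'
  · rw [adapted_iff hn]
    intro c
    have h1 := h c
    rcases hx : signal n c j with - | x
    · simpa [hx] using h1
    · simpa [hx, quiet c x hx] using h1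

theorem isSink_of_adapted_append (hn : 2 ≤ n) {Q : TwistedDynkinQuiver n} {a b : Word n}
    {i : Fin (n + 1)} (h : Q.Adapted (a ++ i :: b))
    (ha : ∀ l ∈ a, vertex n l ≠ vertex n i ∧ ¬ Adj n l i) : Q.IsSink i := by
  rw [isSink_iff hn]
  intro c x hx
  have h1 := (adapted_iff hn _ _).mp h c
  have h2 : a.filterMap (signal n c) = [] := by
    rw [List.filterMap_eq_nil_iff]
    intro l hl
    exact signal_eq_none_of_not_adj hn (fun h => (ha l hl).2 (adj_symm h)) (ha l hl).1.symm hx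
  rw [List.filterMap_append, h2, List.filterMap_cons, hx] at h1
  exact h1.1.symm

/-- Adapted words with the same numbers of letters on every vertex are commutation equivalent. -/
theorem Adapted.commEquiv (hn : 2 ≤ n) {Q : TwistedDynkinQuiver n} {w w' : Word n}
    (h : Q.Adapted w) (h' : Q.Adapted w') (hc : ∀ v < n, vcount n v w = vcount n v w') :
    CommEquiv n w w' := by
  induction w generalizing Q w' with
  | nil =>
    cases w' with
    | nil => exact .refl _
    | cons i w' =>
      have := hc _ (vertex_lt hn i)
      simp [vcount_cons] at this
  | cons i w ih =>
    -- The first letter of one word is a sink of `Q`, so it can be pulled to the front of the other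
    -- past letters that commute with it.
    obtain ⟨a, b, rfl, ha, hab⟩ := Adapted.pull hn h' h.1 (by
      rw [← hc _ (vertex_lt hn i), vcount_cons, if_pos rfl]; omega)
    refine .trans _ (i :: (a ++ b)) _ (CommEquiv.cons (ih h.2 hab.2 fun v hv => ?_) i)
      (.symm _ _ (commEquiv_move hn b fun l hl => (ha l hl).2))
    have := hc v hv
    simp only [vcount_cons, vcount_append] at this ⊢
    omega

theorem CommStep.symm {u v : Word n} (h : CommStep n u v) : CommStep n v u := by
  obtain ⟨a, b, i, j, hc, rfl, rfl⟩ := h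
  exact ⟨a, b, j, i, hc.symm, rfl, rfl⟩

/-- An invariant of commutation steps is an invariant of commutation classes. -/
theorem CommEquiv.iff_of_step {p : Word n → Prop} (hp : ∀ u v, CommStep n u v → p u → p v)
    {u v : Word n} (h : CommEquiv n u v) : p u ↔ p v := by
  induction h with
  | rel u v h => exact ⟨hp _ _ h, hp _ _ h.symm⟩
  | refl => rfl
  | symm _ _ _ ih => exact ih.symm
  | trans _ _ _ _ _ ih ih' => exact ih.trans ih'

/-- Commuting letters on different vertices share no channel, so exchanging them changes no sequence
of signals. Letters on the same vertex would repeat a signal on an edge and cannot be consecutive.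
-/
theorem CommStep.adapted (hn : 2 ≤ n) {Q : TwistedDynkinQuiver n} {u v : Word n}
    (h : CommStep n u v) (hu : Q.Adapted u) : Q.Adapted v := by
  obtain ⟨a, b, i, j, hc, rfl, rfl⟩ := h
  rw [adapted_iff hn] at hu ⊢
  have hadj := not_adj_of_commute hn hc
  have hv : vertex n i ≠ vertex n j := by
    intro hv
    obtain ⟨c, x, hx, hx'⟩ := exists_signal_of_vertex_eq hn hv
    have h1 := hu c
    rw [List.filterMap_append] at h1
    obtain ⟨y, h2⟩ := h1.append_right
    simp only [List.filterMap_cons, hx, hx'] at h2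
    have h3 := h2.1
    have h4 := h2.2.1
    rw [h3] at h4
    simp at h4
  intro c
  have h1 := hu c
  rcases hx : signal n c i with - | x
  · simpa [List.filterMap_cons, hx] using h1
  · have := signal_eq_none_of_not_adj hn hadj hv hx
    simpa [List.filterMap_cons, hx, this] using h1

theorem CommEquiv.adapted (hn : 2 ≤ n) {Q : TwistedDynkinQuiver n} {u v : Word n}
    (h : CommEquiv n u v) (hu : Q.Adapted u) : Q.Adapted v :=
  (CommEquiv.iff_of_step (p := Q.Adapted) (fun _ _ h => h.adapted hn) h).mp hu

theorem CommEquiv.perm {u v : Word n} (h : CommEquiv n u v) : u.Perm v := by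
  refine (CommEquiv.iff_of_step (p := fun w => u.Perm w) (fun s t h hs => hs.trans ?_) h).mp
    (List.Perm.refl u)
  obtain ⟨a, b, i, j, -, rfl, rfl⟩ := h
  exact (List.Perm.swap j i b).append_left a

theorem CommEquiv.vcount {u w : Word n} (h : CommEquiv n u w) (v : ℕ) :
    vcount n v u = vcount n v w := h.perm.countP_eq _

theorem CommEquiv.wordProd {u w : Word n} (h : CommEquiv n u w) : wordProd n u = wordProd n w := by
  refine (CommEquiv.iff_of_step (p := fun w => TwistedD.wordProd n u = TwistedD.wordProd n w)
    (fun s t h hs => hs.trans ?_) h).mp rfl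
  obtain ⟨a, b, i, j, h, rfl, rfl⟩ := h
  simp only [wordProd_append, wordProd_cons, ← mul_assoc]
  rw [mul_assoc _ (simpleRefl n i), h, mul_assoc _ (simpleRefl n j)]

/-- An adapted word containing all vertices determines the quiver. -/
theorem Adapted.unique (hn : 2 ≤ n) {Q Q' : TwistedDynkinQuiver n} {w : Word n}
    (h : Q.Adapted w) (h' : Q'.Adapted w) (hc : ∀ v < n, 0 < vcount n v w) : Q = Q' := by
  apply state_ext
  intro c
  obtain ⟨j, hj, x, hx⟩ : ∃ j ∈ w, ∃ x, signal n c j = some x := by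
    cases c with
    | none =>
      obtain ⟨j, hj, hv⟩ := vcount_pos_iff.mp (hc (n - 1) (by omega))
      refine ⟨j, hj, ?_⟩
      simp only [vertex, signal] at *
      split_ifs <;> first | omega | simp
    | some k =>
      obtain ⟨j, hj, hv⟩ := vcount_pos_iff.mp (hc k (by have := k.2; omega))
      exact ⟨j, hj, false, by simp [signal, hv]⟩
  have h1 := (adapted_iff hn _ _).mp h c
  have h2 := (adapted_iff hn _ _).mp h' c
  rcases hl : w.filterMap (signal n c) with - | ⟨y, l⟩
  · rw [List.filterMap_eq_nil_iff] at hl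
    rw [hl j hj] at hx
    simp at hx
  · rw [hl] at h1 h2
    rw [h1.head_eq, h2.head_eq]

theorem count_signal_edge (k : Fin (n - 1)) (w : Word n) :
    (w.filterMap (signal n (some k))).count true = vcount n (k + 1) w ∧
      (w.filterMap (signal n (some k))).count false = vcount n k w := by
  induction w with
  | nil => simp
  | cons i w ih =>
    rw [List.filterMap_cons, vcount_cons, vcount_cons]
    simp only [signal] at *
    split_ifs <;> first | omega | simp_all

theorem length_signal_fork (w : Word n) :
    (w.filterMap (signal n none)).length = vcount n (n - 1) w := by
  induction w with
  | nil => simp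
  | cons i w ih =>
    rw [List.filterMap_cons, vcount_cons]
    simp only [signal, vertex] at *
    split_ifs <;> first | omega | simp_all

/-- Every transversal word is adapted to some quiver. -/
theorem exists_quiver_adapted (hn : 2 ≤ n) {w : Word n} (h : ∀ v < n, vcount n v w = 1) :
    ∃ Q : TwistedDynkinQuiver n, Q.Adapted w := by
  -- The fork receives a single signal, and an edge receives one `true` and one `false`. Such
  -- sequences always alternate, and their first entries define the quiver.
  have key : ∀ c, ∃ b, Alternating b (w.filterMap (signal n c)) := by
    intro c
    cases c with
    | none =>
      have := length_signal_fork w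
      rw [h _ (by omega), List.length_eq_one_iff] at this
      obtain ⟨x, hx⟩ := this
      exact ⟨x, by rw [hx]; exact ⟨rfl, trivial⟩⟩
    | some k =>
      have := count_signal_edge k w
      rw [h _ (by have := k.2; omega), h _ (by have := k.2; omega)] at this
      obtain ⟨h1, h2⟩ := this
      have h3 := List.count_true_add_count_false (w.filterMap (signal n (some k)))
      rw [h1, h2, eq_comm, List.length_eq_two] at h3
      obtain ⟨x, y, hl⟩ := h3
      rw [hl] at h1 h2 ⊢
      refine ⟨x, rfl, ?_, trivial⟩
      cases x <;> cases y <;> simp_all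
  choose f hf using key
  exact ⟨ofState f, (adapted_iff hn _ _).mpr fun c => by rw [state_ofState]; exact hf c⟩

/-! ### The diagram automorphism on quivers and words -/

/-- The quiver with the two indices of the last vertex exchanged. -/
def twist (Q : TwistedDynkinQuiver n) : TwistedDynkinQuiver n := ⟨!Q.swapped, Q.toRight⟩

theorem signal_edge_vee (k : Fin (n - 1)) (i : Fin (n + 1)) :
    signal n (some k) (vee n i) = signal n (some k) i := by
  simp only [signal, vertex_vee]

theorem signal_fork_vee (hn : 2 ≤ n) (i : Fin (n + 1)) :
    signal n none (vee n i) = (signal n none i).map not := by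
  have hv : ((vee n i : Fin (n + 1)) : ℕ) =
      if (i : ℕ) = n - 1 then n else if (i : ℕ) = n then n - 1 else i := by
    simp only [vee, Equiv.swap_apply_def, Fin.ext_iff, Fin.val_last]
    split_ifs <;> rfl
  simp only [signal, hv]
  split_ifs <;> first | omega | rfl

/-- The index `i` is visible and all arrows at its vertex leave it. -/
def Opposed (Q : TwistedDynkinQuiver n) (i : Fin (n + 1)) : Prop :=
  ∀ c b, signal n c i = some b → state Q c = !b

theorem Opposed.twist (hn : 2 ≤ n) {Q : TwistedDynkinQuiver n} {i : Fin (n + 1)}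
    (h : Opposed Q i) : Opposed (twist Q) (vee n i) := by
  intro c b hb
  cases c with
  | none =>
    rw [signal_fork_vee hn, Option.map_eq_some_iff] at hb
    obtain ⟨x, hx, rfl⟩ := hb
    have := h none x hx
    simp only [state, TwistedD.twist] at *
    rw [this]
  | some k =>
    rw [signal_edge_vee] at hb
    exact h (some k) b hb

theorem IsSink.twist (hn : 2 ≤ n) {Q : TwistedDynkinQuiver n} {i : Fin (n + 1)}
    (h : Q.IsSink i) : (twist Q).IsSink (vee n i) := by
  rw [isSink_iff hn] at *
  intro c b hb
  cases c with
  | none =>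
    rw [signal_fork_vee hn, Option.map_eq_some_iff] at hb
    obtain ⟨x, hx, rfl⟩ := hb
    have := h none x hx
    simp only [state, TwistedD.twist] at *
    rw [this]
  | some k =>
    rw [signal_edge_vee] at hb
    exact h (some k) b hb

theorem reflect_twist (hn : 2 ≤ n) {Q : TwistedDynkinQuiver n} {i : Fin (n + 1)}
    (h : Q.IsSink i) : (twist Q).reflect (vee n i) = twist (Q.reflect i) := by
  apply state_ext
  intro c
  rw [state_reflect hn (IsSink.twist hn h)]
  have := state_reflect hn h c
  cases c with
  | none =>
    rw [signal_fork_vee hn]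
    simp only [state, twist] at *
    rw [this]
    simp
  | some k =>
    rw [signal_edge_vee]
    simp only [state, twist] at *
    rw [this]

theorem Adapted.twist (hn : 2 ≤ n) {Q : TwistedDynkinQuiver n} {w : Word n} (h : Q.Adapted w) :
    (twist Q).Adapted (w.map (vee n)) := by
  induction w generalizing Q with
  | nil => trivial
  | cons i w ih =>
    refine ⟨IsSink.twist hn h.1, ?_⟩
    rw [reflect_twist hn h.1]
    exact ih h.2

theorem IsSink.twist_iterate (hn : 2 ≤ n) {Q : TwistedDynkinQuiver n} {i : Fin (n + 1)}
    (h : Q.IsSink i) (m : ℕ) : (TwistedD.twist^[m] Q).IsSink ((vee n)^[m] i) := by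
  induction m with
  | zero => exact h
  | succ m ih =>
    rw [Function.iterate_succ_apply', Function.iterate_succ_apply']
    exact IsSink.twist hn ih

theorem Opposed.twist_iterate (hn : 2 ≤ n) {Q : TwistedDynkinQuiver n} {i : Fin (n + 1)}
    (h : Opposed Q i) (m : ℕ) : Opposed (TwistedD.twist^[m] Q) ((vee n)^[m] i) := by
  induction m with
  | zero => exact h
  | succ m ih =>
    rw [Function.iterate_succ_apply', Function.iterate_succ_apply']
    exact ih.twist hn

theorem Adapted.twist_iterate (hn : 2 ≤ n) {Q : TwistedDynkinQuiver n} {w : Word n}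
    (h : Q.Adapted w) (m : ℕ) : (TwistedD.twist^[m] Q).Adapted (w.map ((vee n)^[m])) := by
  induction m with
  | zero => simpa using h
  | succ m ih =>
    rw [Function.iterate_succ_apply', Function.iterate_succ', ← List.map_map]
    exact Adapted.twist hn ih

theorem swapped_twist_iterate (Q : TwistedDynkinQuiver n) (m : ℕ) :
    (twist^[m] Q).swapped = xor Q.swapped m.bodd := by
  induction m with
  | zero => simp
  | succ m ih => rw [Function.iterate_succ_apply']; simp [twist, ih]

theorem toRight_twist_iterate (Q : TwistedDynkinQuiver n) (m : ℕ) :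
    (twist^[m] Q).toRight = Q.toRight := by
  induction m with
  | zero => rfl
  | succ m ih => rw [Function.iterate_succ_apply']; exact ih

/-- The effect of an adapted word with the same number of letters on every vertex. -/
theorem after_eq_twist (hn : 2 ≤ n) {Q : TwistedDynkinQuiver n} {w : Word n} (h : Q.Adapted w)
    {m : ℕ} (hc : ∀ v < n, vcount n v w = m) : after Q w = twist^[m] Q := by
  -- The fork is exchanged once for each of the `m` letters on the last vertex; an edge with equally
  -- many letters at both ends returns to its orientation.
  apply TwistedDynkinQuiver.ext
  · rw [swapped_after hn h, swapped_twist_iterate, hc _ (by omega)]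
  · rw [toRight_twist_iterate]
    ext k
    have := vcount_toRight hn h k
    rw [hc _ (by have := k.2; omega), hc _ (by have := k.2; omega)] at this
    revert this
    cases (after Q w).toRight k <;> cases Q.toRight k <;> simp

theorem vertex_vee_iterate (m : ℕ) (i : Fin (n + 1)) :
    vertex n ((vee n)^[m] i) = vertex n i := by
  induction m with
  | zero => rfl
  | succ m ih => rw [Function.iterate_succ_apply', vertex_vee, ih]

theorem vcount_map_vee (m v : ℕ) (w : Word n) :
    vcount n v (w.map ((vee n)^[m])) = vcount n v w := by
  simp only [vcount, List.countP_map, Function.comp_def, vertex_vee_iterate]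

/-- Each transversal pass restores the edges and exchanges the fork indices, so the next pass has to
use the `∨`-image of the previous one. -/
theorem adapted_flatMap_vee (hn : 2 ≤ n) {Q : TwistedDynkinQuiver n} {w : Word n}
    (h : Q.Adapted w) (hc : ∀ v < n, vcount n v w = 1) (m : ℕ) :
    Q.Adapted ((List.range m).flatMap fun k => w.map ((vee n)^[k])) ∧
      ∀ v < n, vcount n v ((List.range m).flatMap fun k => w.map ((vee n)^[k])) = m := by
  induction m with
  | zero => simp [Adapted]
  | succ m ih =>
    rw [List.range_succ, List.flatMap_append, List.flatMap_singleton]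
    refine ⟨(adapted_append _ _ _).mpr ⟨ih.1, ?_⟩, fun v hv => ?_⟩
    · rw [after_eq_twist hn ih.1 ih.2]
      exact Adapted.twist_iterate hn h m
    · rw [vcount_append, ih.2 v hv, vcount_map_vee, hc v hv]

/-- A word with `n + 1` letters on every vertex of the path. -/
def Complete (n : ℕ) (w : Word n) : Prop := ∀ v < n, vcount n v w = n + 1

/-- This length is the number of positive roots of `D_{n+1}`. -/
theorem Complete.length (hn : 2 ≤ n) {w : Word n} (h : Complete n w) : w.length = n * (n + 1) := by
  rw [length_eq_sum_vcount hn, Finset.sum_congr rfl fun v hv => h v (Finset.mem_range.mp hv)]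
  simp

theorem adapted_twistedPower (hn : 2 ≤ n) {Q : TwistedDynkinQuiver n} {w : Word n}
    (h : Q.Adapted w) (hc : ∀ v < n, vcount n v w = 1) :
    Q.Adapted (twistedPower n w) ∧ Complete n (twistedPower n w) :=
  adapted_flatMap_vee hn h hc (n + 1)

end Words

/-! ### Twisted Coxeter elements and their conjugation by sinks -/

section Coxeter

theorem sigma_apply (v : V n) (a : Fin (n + 1)) :
    sigma n v a = if a = Fin.last n then -v a else v a := rfl

theorem sigma_mul_self : sigma n * sigma n = 1 := by
  refine LinearMap.ext fun v => funext fun a => ?_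
  simp only [Module.End.mul_apply, sigma_apply, Module.End.one_apply]
  split_ifs <;> simp

theorem sigma_dotProduct (v w : V n) : sigma n v ⬝ᵥ sigma n w = v ⬝ᵥ w := by
  refine Finset.sum_congr rfl fun a _ => ?_
  simp only [sigma_apply]
  split_ifs <;> ring

theorem sigma_mul_simpleRefl (hn : 2 ≤ n) (i : Fin (n + 1)) :
    sigma n * simpleRefl n i = simpleRefl n (vee n i) * sigma n := by
  refine LinearMap.ext fun v => ?_
  simp only [Module.End.mul_apply, simpleRefl_apply, map_sub, map_smul]
  rw [← sigma_simpleRoot n (by omega), sigma_dotProduct]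

theorem sigma_mul_wordProd (hn : 2 ≤ n) (w : Word n) :
    sigma n * wordProd n w = wordProd n (w.map (vee n)) * sigma n := by
  induction w with
  | nil => simp
  | cons i w ih =>
    rw [List.map_cons, wordProd_cons, wordProd_cons, ← mul_assoc, sigma_mul_simpleRefl hn,
      mul_assoc, ih, mul_assoc]

theorem sigma_pow_mul_wordProd (hn : 2 ≤ n) (w : Word n) (k : ℕ) :
    sigma n ^ k * wordProd n w = wordProd n (w.map ((vee n)^[k])) * sigma n ^ k := by
  induction k with
  | zero => simp
  | succ k ih =>
    rw [pow_succ', mul_assoc, ih, ← mul_assoc, sigma_mul_wordProd hn, List.map_map,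
      ← Function.iterate_succ', mul_assoc]

theorem sigma_pow_mul_self (k : ℕ) : sigma n ^ k * sigma n ^ k = 1 := by
  rw [← (Commute.refl (sigma n)).mul_pow, sigma_mul_self, one_pow]

theorem sigma_pow_simpleRoot (hn : 2 ≤ n) (k : ℕ) (i : Fin (n + 1)) :
    (sigma n ^ k) (simpleRoot n i) = simpleRoot n ((vee n)^[k] i) := by
  induction k with
  | zero => rfl
  | succ k ih =>
    rw [pow_succ', Module.End.mul_apply, ih, sigma_simpleRoot n (by omega),
      Function.iterate_succ_apply']

/-- The word `w^{k∨}` represents `σ^k w σ^k`. The inner powers of `σ` telescope because `σ² = 1`. -/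
theorem wordProd_flatMap_vee (hn : 2 ≤ n) (w : Word n) (m : ℕ) :
    wordProd n ((List.range m).flatMap fun k => w.map ((vee n)^[k])) =
      coxeterOf n w ^ m * sigma n ^ m := by
  induction m with
  | zero => simp
  | succ m ih =>
    have h1 : wordProd n (w.map ((vee n)^[m])) = sigma n ^ m * wordProd n w * sigma n ^ m := by
      rw [sigma_pow_mul_wordProd hn, mul_assoc, sigma_pow_mul_self, mul_one]
    rw [List.range_succ, List.flatMap_append, List.flatMap_singleton, wordProd_append, ih, h1,
      pow_succ (coxeterOf n w), pow_succ' (sigma n), coxeterOf]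
    calc _ = (wordProd n w * sigma n) ^ m * (sigma n ^ m * sigma n ^ m) * wordProd n w *
          sigma n ^ m := by simp only [mul_assoc]
      _ = (wordProd n w * sigma n) ^ m * wordProd n w * (sigma n * sigma n) * sigma n ^ m := by
          rw [sigma_pow_mul_self, sigma_mul_self, mul_one, mul_one]
      _ = _ := by simp only [mul_assoc]

/-- Rotating a letter of a word conjugates its twisted Coxeter element. -/
theorem coxeterOf_rotate (hn : 2 ≤ n) (i : Fin (n + 1)) (t : Word n) :
    coxeterOf n (t ++ [vee n i]) = simpleRefl n i * coxeterOf n (i :: t) * simpleRefl n i := by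
  rw [coxeterOf, coxeterOf, wordProd_append, wordProd_singleton, wordProd_cons, mul_assoc,
    ← sigma_mul_simpleRefl hn]
  simp only [← mul_assoc]
  rw [simpleRefl_mul_self hn, one_mul]

theorem CommEquiv.coxeterOf {u w : Word n} (h : CommEquiv n u w) :
    coxeterOf n u = coxeterOf n w := by
  rw [TwistedD.coxeterOf, TwistedD.coxeterOf, h.wordProd]

theorem coxeterOf_eq_of_adapted (hn : 2 ≤ n) {Q : TwistedDynkinQuiver n} {w w' : Word n}
    (h : Q.Adapted w) (hc : ∀ v < n, vcount n v w = 1)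
    (h' : Q.Adapted w') (hc' : ∀ v < n, vcount n v w' = 1) :
    coxeterOf n w = coxeterOf n w' :=
  CommEquiv.coxeterOf (Adapted.commEquiv hn h h' fun v hv => by rw [hc v hv, hc' v hv])

/-- Every sink starts a transversal adapted word. -/
theorem exists_transversal_cons (hn : 2 ≤ n) {Q : TwistedDynkinQuiver n} {i : Fin (n + 1)}
    (hi : Q.IsSink i) : ∃ t, Q.Adapted (i :: t) ∧ ∀ v < n, vcount n v (i :: t) = 1 := by
  have h1 : Q.Adapted [i] := ⟨hi, trivial⟩
  obtain ⟨t, ht, hc⟩ := exists_completion hn h1 1 (by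
    intro v hv
    rw [vcount_cons, vcount_nil]
    split_ifs <;> simp)
  exact ⟨t, ht, hc⟩

/-- Reflecting the quiver at a sink conjugates the twisted Coxeter element. -/
theorem coxeterOf_reflect (hn : 2 ≤ n) {Q : TwistedDynkinQuiver n} {i : Fin (n + 1)}
    (hi : Q.IsSink i) {w w' : Word n}
    (h : Q.Adapted w) (hc : ∀ v < n, vcount n v w = 1)
    (h' : (Q.reflect i).Adapted w') (hc' : ∀ v < n, vcount n v w' = 1) :
    coxeterOf n w' = simpleRefl n i * coxeterOf n w * simpleRefl n i := by
  obtain ⟨t, ht, htc⟩ := exists_transversal_cons hn hi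
  rw [coxeterOf_eq_of_adapted hn h hc ht htc, ← coxeterOf_rotate hn]
  -- A transversal word `i t` turns `Q` into its twist, where `∨ i` is a sink. Hence the rotated
  -- word `t (∨ i)` is adapted to `i Q`.
  have hafter := after_eq_twist hn ht htc
  rw [after_cons] at hafter
  refine coxeterOf_eq_of_adapted hn h' hc' ((adapted_append _ _ _).mpr ⟨ht.2, ?_⟩) fun v hv => ?_
  · rw [hafter]
    exact ⟨IsSink.twist hn hi, trivial⟩
  · have := htc v hv
    rw [vcount_cons] at this
    rw [vcount_append, vcount_cons, vcount_nil, vertex_vee]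
    omega

/-- Any two quivers are related by reflections at sinks. -/
theorem exists_adapted_after_eq (hn : 2 ≤ n) (Q Q' : TwistedDynkinQuiver n) :
    ∃ w, Q.Adapted w ∧ after Q w = Q' := by
  let t : TwistedDynkinQuiver n → ℕ → ℕ := fun P j =>
    if h : j < n - 1 then (P.toRight ⟨j, h⟩).toNat else 0
  have ht : ∀ P (k : Fin (n - 1)), t P k = (P.toRight k).toNat := fun P k => by simp [t]
  -- The counts must increase along edge `k` by the old bit minus the new bit. Summing old bits to
  -- the left and new bits to the right achieves this without negative numbers.
  let c₀ : ℕ → ℕ := fun k => ∑ j ∈ Finset.range k, t Q j + ∑ j ∈ Finset.Ico k (n - 1), t Q' j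
  have hc₀ : ∀ k : Fin (n - 1), c₀ (k + 1) + (Q'.toRight k).toNat = c₀ k + (Q.toRight k).toNat := by
    intro k
    simp only [c₀]
    rw [Finset.sum_range_succ, Finset.sum_eq_sum_Ico_succ_bot k.2, ht, ht]
    omega
  -- Adding a constant to all counts keeps the edges and corrects the parity at the fork.
  obtain ⟨m, hm⟩ : ∃ m : ℕ, xor Q.swapped (c₀ (n - 1) + m).bodd = Q'.swapped := by
    generalize c₀ (n - 1) = x
    by_cases h : xor Q.swapped x.bodd = Q'.swapped
    · exact ⟨0, h⟩
    · refine ⟨1, ?_⟩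
      revert h
      rw [Nat.bodd_add]
      cases Q.swapped <;> cases Q'.swapped <;> cases x.bodd <;> simp
  obtain ⟨w, hw, hcw⟩ := exists_adapted hn Q (fun v => c₀ v + m) fun k => by
    have := hc₀ k
    have := Bool.toNat_le (Q'.toRight k)
    omega
  refine ⟨w, hw, TwistedDynkinQuiver.ext ?_ (funext fun k => ?_)⟩
  · rw [swapped_after hn hw, hcw _ (by omega), hm]
  · have h1 := vcount_toRight hn hw k
    rw [hcw _ (by have := k.2; omega), hcw _ (by have := k.2; omega)] at h1
    have h2 := hc₀ k
    have h3 : ((after Q w).toRight k).toNat = (Q'.toRight k).toNat := by omega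
    revert h3
    cases (after Q w).toRight k <;> cases Q'.toRight k <;> simp

/-- A property preserved by reflections at sinks holds for all quivers if it holds for one. -/
theorem forall_quiver_of_reflect (hn : 2 ≤ n) {p : TwistedDynkinQuiver n → Prop}
    (hp : ∀ Q i, Q.IsSink i → p Q → p (Q.reflect i)) {Q₀ : TwistedDynkinQuiver n} (h : p Q₀)
    (Q : TwistedDynkinQuiver n) : p Q := by
  obtain ⟨w, hw, rfl⟩ := exists_adapted_after_eq hn Q₀ Q
  induction w generalizing Q₀ with
  | nil => exact h
  | cons i w ih => exact ih (hp _ _ hw.1 h) hw.2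

/-! ### The base twisted Coxeter element and its powers -/

/-- The word `1 2 ⋯ n`. -/
def baseWord (n : ℕ) : Word n := (List.finRange n).map Fin.castSucc

theorem baseWord_eq : baseWord n = (List.range n).map (Fin.ofNat (n + 1)) := by
  rw [baseWord, ← List.map_coe_finRange_eq_range, List.map_map]
  refine List.map_congr_left fun i _ => ?_
  ext
  simp

theorem vcount_baseWord (v : ℕ) (hv : v < n) : vcount n v (baseWord n) = 1 := by
  rw [vcount, baseWord, List.countP_map]
  have h1 : ((fun j => decide (vertex n j = v)) ∘ Fin.castSucc : Fin n → Bool) =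
      fun j => j == ⟨v, hv⟩ := by
    funext j
    have := j.2
    rw [Bool.eq_iff_iff]
    change decide (vertex n j.castSucc = v) = true ↔ (j == ⟨v, hv⟩) = true
    rw [decide_eq_true_eq, beq_iff_eq, Fin.ext_iff]
    simp only [vertex, Fin.val_castSucc]
    omega
  rw [h1, ← List.count, List.count_eq_one_of_mem (List.nodup_finRange n) (List.mem_finRange _)]

theorem wordProd_range_apply (m : ℕ) (hm : m ≤ n) (v : V n) (a : Fin (n + 1)) :
    wordProd n ((List.range m).map (Fin.ofNat (n + 1))) v a =
      if (a : ℕ) = 0 then v ⟨m, by omega⟩ else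
        if _h : (a : ℕ) ≤ m then v ⟨a - 1, by omega⟩ else v a := by
  induction m generalizing v with
  | zero =>
    simp only [List.range_zero, List.map_nil, wordProd_nil, Module.End.one_apply]
    split_ifs with h h'
    · congr 1; ext; exact h
    · omega
    · rfl
  | succ m ih =>
    have hr : ∀ b : Fin (n + 1), simpleRefl n (Fin.ofNat (n + 1) m) v b =
        if (b : ℕ) = m then v ⟨m + 1, by omega⟩ else
          if (b : ℕ) = m + 1 then v ⟨m, by omega⟩ else v b := by
      intro b
      have e : Fin.ofNat (n + 1) m = ⟨m, by omega⟩ := by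
        ext; simp [Nat.mod_eq_of_lt (by omega : m < n + 1)]
      rw [e, simpleRefl_apply, dotProduct_simpleRoot_of_lt (by simp; omega)]
      simp only [Pi.sub_apply, Pi.smul_apply, smul_eq_mul]
      rw [simpleRoot_apply_of_lt (by simp; omega)]
      simp only
      split_ifs with h1 h2
      · rw [show b = ⟨m, by omega⟩ from Fin.ext h1]; ring
      · rw [show b = ⟨m + 1, by omega⟩ from Fin.ext h2]; ring
      · ring
    rw [List.range_succ, List.map_append, List.map_singleton, wordProd_append_apply,
      wordProd_singleton, ih (by omega)]
    simp only [hr]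
    split_ifs <;> first | omega | rfl | (congr 1; ext; simp; omega)

/-- The letters `1, …, n` act by adjacent transpositions of coordinates, whose product is a cyclic
shift; `σ` supplies the sign on wrapping around. -/
theorem coxeterOf_baseWord_apply (hn : 2 ≤ n) (v : V n) (a : Fin (n + 1)) :
    coxeterOf n (baseWord n) v a =
      if (a : ℕ) = 0 then -v (Fin.last n) else v ⟨a - 1, by omega⟩ := by
  rw [coxeterOf, Module.End.mul_apply, baseWord_eq, wordProd_range_apply n le_rfl]
  simp only [sigma_apply, Fin.ext_iff, Fin.val_last]
  split_ifs <;> first | omega | rfl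

theorem coxeterOf_baseWord_pow_apply (hn : 2 ≤ n) (m : ℕ) (hm : m ≤ n + 1) (v : V n)
    (a : Fin (n + 1)) : (coxeterOf n (baseWord n) ^ m) v a =
      if h : (a : ℕ) < m then -v ⟨n + 1 + a - m, by omega⟩ else v ⟨a - m, by omega⟩ := by
  induction m generalizing a with
  | zero => simp
  | succ m ih =>
    rw [pow_succ', Module.End.mul_apply, coxeterOf_baseWord_apply hn]
    simp only [ih (by omega), Fin.val_last]
    split_ifs <;> first | omega | (congr 1; congr 1; ext; simp; omega) | (congr 1; ext; simp; omega)

theorem coxeterOf_baseWord_pow (hn : 2 ≤ n) : coxeterOf n (baseWord n) ^ (n + 1) = -1 := by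
  refine LinearMap.ext fun v => funext fun a => ?_
  rw [coxeterOf_baseWord_pow_apply hn _ le_rfl, dif_pos a.2]
  simp

/-- A twisted Coxeter element has order `2 (n + 1)`, and its power of exponent `n + 1` is `-1`. -/
theorem coxeterOf_pow (hn : 2 ≤ n) {Q : TwistedDynkinQuiver n} {w : Word n}
    (h : Q.Adapted w) (hc : ∀ v < n, vcount n v w = 1) : coxeterOf n w ^ (n + 1) = -1 := by
  obtain ⟨Q₀, h₀⟩ := exists_quiver_adapted hn (vcount_baseWord (n := n))
  -- Reflection at a sink conjugates the element, and `-1` is central, so the base word suffices.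
  refine forall_quiver_of_reflect hn (p := fun Q => ∀ w, Q.Adapted w →
    (∀ v < n, vcount n v w = 1) → coxeterOf n w ^ (n + 1) = -1) ?_ (Q₀ := Q₀) ?_ Q w h hc
  · intro Q i hi hQ w' hw' hc'
    obtain ⟨t, ht, htc⟩ := exists_transversal_cons hn hi
    have key : ∀ m, (simpleRefl n i * coxeterOf n (i :: t) * simpleRefl n i) ^ m =
        simpleRefl n i * coxeterOf n (i :: t) ^ m * simpleRefl n i := by
      intro m
      induction m with
      | zero => simp [simpleRefl_mul_self hn]
      | succ m ih =>
        rw [pow_succ, ih, pow_succ]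
        calc _ = simpleRefl n i * coxeterOf n (i :: t) ^ m * (simpleRefl n i * simpleRefl n i) *
              coxeterOf n (i :: t) * simpleRefl n i := by simp only [mul_assoc]
          _ = _ := by rw [simpleRefl_mul_self hn, mul_one]; simp only [mul_assoc]
    rw [coxeterOf_reflect hn hi ht htc hw' hc', key, hQ _ ht htc]
    refine LinearMap.ext fun v => ?_
    change simpleRefl n i (-simpleRefl n i v) = -v
    rw [map_neg, simpleRefl_simpleRefl hn]
  · intro w hw hc
    rw [coxeterOf_eq_of_adapted hn hw hc h₀ vcount_baseWord, coxeterOf_baseWord_pow hn]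

/-! ### Complete adapted words are the adapted reduced words of the longest element -/

/-- The complete adapted words represent the longest element. -/
theorem wordProd_of_complete (hn : 2 ≤ n) {Q : TwistedDynkinQuiver n} {w : Word n}
    (h : Q.Adapted w) (hc : Complete n w) : wordProd n w = -sigma n ^ (n + 1) := by
  obtain ⟨u, hu, huc⟩ := exists_adapted_const hn Q 1
  obtain ⟨h1, h2⟩ := adapted_twistedPower hn hu huc
  rw [(Adapted.commEquiv hn h h1 fun v hv => by rw [hc v hv, h2 v hv]).wordProd, twistedPower,
    wordProd_flatMap_vee hn, coxeterOf_pow hn hu huc]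
  rfl

theorem sigma_eps (a : Fin (n + 1)) :
    sigma n (eps n a) = if a = Fin.last n then -eps n a else eps n a := by
  ext b
  rw [sigma_apply]
  split_ifs with h1 h2 h2
  · rfl
  · rw [eps, Pi.single_apply, if_neg (by rintro rfl; exact h2 h1), neg_zero]
  · rw [Pi.neg_apply, eps, Pi.single_apply, if_neg (by rintro rfl; exact h1 h2), neg_zero]
  · rfl

theorem IsPosRoot.sigma {v : V n} (h : IsPosRoot n v) : IsPosRoot n (sigma n v) := by
  obtain ⟨a, b, hab, h⟩ := h
  refine ⟨a, b, hab, ?_⟩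
  have ha : a ≠ Fin.last n := (hab.trans_le (Fin.le_last b)).ne
  rcases h with rfl | rfl
  · rw [map_sub, sigma_eps, sigma_eps, if_neg ha]
    split_ifs
    · right; abel
    · left; rfl
  · rw [map_add, sigma_eps, sigma_eps, if_neg ha]
    split_ifs
    · left; abel
    · right; rfl

theorem IsPosRoot.sigma_pow {v : V n} (h : IsPosRoot n v) (k : ℕ) :
    IsPosRoot n ((TwistedD.sigma n ^ k) v) := by
  induction k with
  | zero => exact h
  | succ k ih => rw [pow_succ', Module.End.mul_apply]; exact ih.sigma

/-- Every positive root is a root of every word for the longest element. -/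
theorem mem_rootsOf_of_wordProd_eq (hn : 2 ≤ n) {w : Word n}
    (h : wordProd n w = -sigma n ^ (n + 1)) {v : V n} (hv : IsPosRoot n v) :
    v ∈ rootsOf n w := by
  -- If the inverse of `w` sent `v` to a positive root, then `-σ^(n+1)` would send that root back to
  -- `v`; but `σ` preserves positivity.
  refine mem_rootsOf_of_inversion hn hv fun h' => ?_
  have h1 := (h'.sigma_pow (n + 1)).not_neg
  apply h1
  have h2 := LinearMap.congr_fun h (wordProd n w.reverse v)
  rw [← Module.End.mul_apply, wordProd_mul_reverse hn] at h2
  rw [← LinearMap.neg_apply, ← h2]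
  exact hv

/-- There are at least `n (n + 1)` positive roots. -/
theorem le_length_of_forall_mem {l : List (V n)} (h : ∀ v, IsPosRoot n v → v ∈ l) :
    n * (n + 1) ≤ l.length := by
  classical
  -- Ordered pairs of distinct indices encode positive roots: increasing pairs give differences,
  -- decreasing pairs give sums.
  let f : Fin (n + 1) × Fin (n + 1) → V n := fun p =>
    if p.1 < p.2 then eps n p.1 - eps n p.2 else eps n p.1 + eps n p.2
  have hf : Set.InjOn f ↑(Finset.univ.offDiag : Finset (Fin (n + 1) × Fin (n + 1))) := by
    rintro ⟨a, b⟩ hab ⟨a', b'⟩ hab' he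
    simp only [Finset.coe_offDiag, Finset.coe_univ, Set.mem_offDiag, Set.mem_univ, true_and]
      at hab hab'
    have ha := congrFun he a
    have hb := congrFun he b
    have ha' := congrFun he a'
    have hb' := congrFun he b'
    simp only [f, eps] at ha hb ha' hb'
    split_ifs at ha hb ha' hb' with h1 h2 h2 <;>
      simp only [Pi.sub_apply, Pi.add_apply, Pi.single_apply] at ha hb ha' hb' <;>
      (ext <;> by_contra hne <;> grind)
  have h1 : (Finset.univ.offDiag.image f).card ≤ l.toFinset.card := by
    refine Finset.card_le_card fun v hv => ?_
    obtain ⟨⟨a, b⟩, hp, rfl⟩ := Finset.mem_image.mp hv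
    rw [List.mem_toFinset]
    apply h
    simp only [Finset.mem_offDiag, Finset.mem_univ, true_and] at hp
    simp only [f]
    split_ifs with hlt
    · exact ⟨a, b, hlt, Or.inl rfl⟩
    · exact ⟨b, a, lt_of_le_of_ne (not_lt.mp hlt) (Ne.symm hp), Or.inr (add_comm _ _)⟩
  rw [Finset.card_image_of_injOn hf, Finset.offDiag_card, Finset.card_univ, Fintype.card_fin] at h1
  have h2 := l.toFinset_card_le
  have h3 : (n + 1) * (n + 1) - (n + 1) = n * (n + 1) := by
    rw [Nat.sub_eq_iff_eq_add (by nlinarith)]; ring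
  omega

/-- The complete adapted words are reduced words of the longest element. -/
theorem isLongestWord_of_complete (hn : 2 ≤ n) {Q : TwistedDynkinQuiver n} {w : Word n}
    (h : Q.Adapted w) (hc : Complete n w) : IsLongestWord n w := by
  have hw := wordProd_of_complete hn h hc
  refine ⟨fun u hu => ?_, fun u hu => ?_⟩
  · rw [hc.length hn, ← length_rootsOf u]
    exact le_length_of_forall_mem fun v hv => mem_rootsOf_of_wordProd_eq hn (hu.trans hw) hv
  · rw [← length_rootsOf u, ← length_rootsOf w]
    -- The roots of a reduced word are distinct and positive, and `w` already has every positive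
    -- root.
    refine ((hu.nodup_rootsOf hn).subperm fun v hv => ?_).length_le
    exact mem_rootsOf_of_wordProd_eq hn hw (hu.isPosRoot hn hv)

/-- A reduced adapted word has at most `n + 1` letters on every vertex. -/
theorem vcount_le_of_isReduced (hn : 2 ≤ n) {Q : TwistedDynkinQuiver n} {w : Word n}
    (h : Q.Adapted w) (hr : IsReduced n w) : ∀ v < n, vcount n v w ≤ n + 1 := by
  induction w using List.reverseRecOn with
  | nil => simp
  | append_singleton u i ih =>
    have hu := ((adapted_append _ _ _).mp h).1
    have hle := ih hu hr.of_append_left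
    intro v hv
    rw [vcount_append, vcount_cons, vcount_nil, zero_add]
    by_contra hcon
    have hlev := hle v hv
    have hiv : vertex n i = v := by
      by_contra hne
      rw [if_neg hne] at hcon
      omega
    subst hiv
    rw [if_pos rfl] at hcon
    have hsink : (after Q u).IsSink i := ((adapted_append _ _ _).mp h).2.1
    -- Complete `u` to `u t`. No letter of `t` lies on the vertex of `i`, and since `i` is a sink
    -- after `u`, none is adjacent to it either. So `t` fixes `α_i` and `u (α_i) = w₀ (α_i)` is
    -- negative, contradicting that `u i` is reduced.
    obtain ⟨t, ht, htc⟩ := exists_completion hn hu (n + 1) hle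
    have ht' := ((adapted_append _ _ _).mp ht).2
    have h0 : vcount n (vertex n i) t = 0 := by
      have := htc _ hv
      rw [vcount_append] at this
      omega
    have hfix : wordProd n t (simpleRoot n i) = simpleRoot n i := by
      refine wordProd_simpleRoot_of_not_adj hn fun l hl => ⟨?_, fun hadj => ?_⟩
      · rintro rfl
        have := vcount_pos_iff.mpr ⟨l, hl, rfl⟩
        omega
      · have hpos := vcount_pos_iff.mpr ⟨l, hl, rfl⟩
        have hl' := vertex_lt hn l
        rcases (adj_iff hn _ _).mp hadj with h1 | h1
        · have h2 := vcount_toRight hn ht' ⟨vertex n l, by omega⟩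
          rw [hsink.2.2 ⟨vertex n l, by omega⟩ h1] at h2
          have h3 := Bool.toNat_le ((after (after Q u) t).toRight ⟨vertex n l, by omega⟩)
          simp only [h1, h0, Bool.toNat_true] at h2
          omega
        · have h2 := vcount_toRight hn ht' ⟨vertex n i, by omega⟩
          rw [hsink.2.1 ⟨vertex n i, by omega⟩ rfl] at h2
          simp only [h1, h0, Bool.toNat_false] at h2
          omega
    have h1 := hr.isPosRoot_wordProd hn (t := [])
    rw [← hfix, ← wordProd_append_apply, wordProd_of_complete hn ht htc, LinearMap.neg_apply,
      sigma_pow_simpleRoot hn] at h1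
    exact (isPosRoot_simpleRoot hn _).not_neg h1

/-- The bound `n + 1` on each of the `n` vertices is attained in total by a longest word, hence on
every vertex. -/
theorem complete_of_isLongestWord (hn : 2 ≤ n) {Q : TwistedDynkinQuiver n} {w : Word n}
    (h : Q.Adapted w) (hl : IsLongestWord n w) : Complete n w := by
  have hle := vcount_le_of_isReduced hn h hl.1
  obtain ⟨u, hu, huc⟩ := exists_adapted_const hn Q (n + 1)
  have h1 := hl.2 u (isLongestWord_of_complete hn hu huc).1
  rw [length_eq_sum_vcount hn, length_eq_sum_vcount hn] at h1
  have h2 : ∑ v ∈ Finset.range n, vcount n v w = ∑ v ∈ Finset.range n, vcount n v u := by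
    refine le_antisymm (Finset.sum_le_sum fun v hv => ?_) h1
    rw [Finset.mem_range] at hv
    rw [huc v hv]
    exact hle v hv
  rw [Finset.sum_eq_sum_iff_of_le fun v hv => by
    rw [Finset.mem_range] at hv
    rw [huc v hv]
    exact hle v hv] at h2
  intro v hv
  rw [h2 v (Finset.mem_range.mpr hv), huc v hv]

theorem mem_adaptedClass_iff (hn : 2 ≤ n) {Q : TwistedDynkinQuiver n} {w : Word n} :
    w ∈ Q.adaptedClass ↔ Q.Adapted w ∧ Complete n w :=
  ⟨fun h => ⟨h.2, complete_of_isLongestWord hn h.2 h.1⟩,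
    fun h => ⟨isLongestWord_of_complete hn h.1 h.2, h.1⟩⟩

theorem adaptedClass_eq_commClass (hn : 2 ≤ n) {Q : TwistedDynkinQuiver n} {w : Word n}
    (h : w ∈ Q.adaptedClass) : Q.adaptedClass = commClass n w := by
  rw [mem_adaptedClass_iff hn] at h
  ext u
  rw [mem_adaptedClass_iff hn]
  constructor
  · rintro ⟨hu, huc⟩
    exact Adapted.commEquiv hn h.1 hu fun v hv => by rw [h.2 v hv, huc v hv]
  · intro hu
    have hu' : CommEquiv n w u := hu
    exact ⟨hu'.adapted hn h.1, fun v hv => by rw [← hu'.vcount, h.2 v hv]⟩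

theorem adaptedClass_nonempty (hn : 2 ≤ n) (Q : TwistedDynkinQuiver n) :
    Q.adaptedClass.Nonempty := by
  obtain ⟨u, hu, huc⟩ := exists_adapted_const hn Q (n + 1)
  exact ⟨u, (mem_adaptedClass_iff hn).mpr ⟨hu, huc⟩⟩

/-! ### Recovering the quiver from its twisted Coxeter element -/

/-- The sinks of a quiver are determined by its twisted Coxeter element. -/
theorem isSink_of_coxeterOf_eq (hn : 2 ≤ n) {Q Q' : TwistedDynkinQuiver n} {w w' : Word n}
    (h : Q.Adapted w) (hc : ∀ v < n, vcount n v w = 1)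
    (h' : Q'.Adapted w') (hc' : ∀ v < n, vcount n v w' = 1)
    (he : coxeterOf n w = coxeterOf n w') {i : Fin (n + 1)} (hi : Q.IsSink i) : Q'.IsSink i := by
  obtain ⟨t, ht, htc⟩ := exists_transversal_cons hn hi
  have hprod : wordProd n (i :: t) = wordProd n w' := by
    rw [coxeterOf_eq_of_adapted hn h hc ht htc, coxeterOf, coxeterOf] at he
    have := congrArg (· * sigma n) he
    simpa only [mul_assoc, sigma_mul_self, mul_one] using this
  have hred : IsReduced n (i :: t) := by
    obtain ⟨s, hs, hsc⟩ := exists_completion hn ht (n + 1) fun v hv => by rw [htc v hv]; omega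
    exact (isLongestWord_of_complete hn hs hsc).1.of_append_left
  -- The inverse of the common element sends `α_i` to a negative root; otherwise `-α_i` would be a
  -- root of the reduced word `i t`.
  have hmem : simpleRoot n i ∈ rootsOf n w' := by
    refine mem_rootsOf_of_inversion hn (isPosRoot_simpleRoot hn i) fun hpos => ?_
    have h1 : wordProd n w'.reverse = wordProd n (i :: t).reverse := by
      calc wordProd n w'.reverse = wordProd n w'.reverse * (wordProd n (i :: t) *
            wordProd n (i :: t).reverse) := by rw [wordProd_mul_reverse hn, mul_one]
        _ = _ := by rw [hprod, ← mul_assoc, wordProd_reverse_mul hn, one_mul]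
    rw [h1, List.reverse_cons, wordProd_append_apply, wordProd_singleton,
      simpleRefl_simpleRoot_self hn, map_neg] at hpos
    have h2 : simpleRoot n i ∈ rootsOf n t :=
      mem_rootsOf_of_inversion hn (isPosRoot_simpleRoot hn i) fun h3 => h3.not_neg hpos
    have h4 : -simpleRoot n i ∈ rootsOf n (i :: t) := by
      rw [rootsOf, ← simpleRefl_simpleRoot_self hn]
      exact List.mem_cons_of_mem _ (List.mem_map_of_mem h2)
    exact (isPosRoot_simpleRoot hn i).not_neg (hred.isPosRoot hn h4)
  obtain ⟨a, j, b, rfl, hroot⟩ := mem_rootsOf.mp hmem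
  have once : ∀ l (x y : Word n), a ++ j :: b = x ++ l :: y →
      ∀ m ∈ x, vertex n m ≠ vertex n l := by
    intro l x y hxy m hm hml
    have h1 := hc' _ (vertex_lt hn l)
    have h2 := vcount_pos_iff.mpr ⟨m, hm, hml⟩
    rw [hxy, vcount_append, vcount_cons, if_pos rfl] at h1
    omega
  -- The letter `j` occurs only once, so `a` preserves the coefficient of `α_j`; hence this
  -- coefficient is nonzero in `a (α_j) = α_i`.
  have hji : j = i := by
    by_contra hne
    have hja : j ∉ a := fun hja => once j a b rfl j hja rfl
    have h1 := coweight_dotProduct_wordProd hn hja (simpleRoot n j)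
    rw [hroot, coweight_dotProduct hn hne] at h1
    exact (coweight_dotProduct_self_pos hn j).ne h1
  subst hji
  refine isSink_of_adapted_append hn h' fun l hl => ⟨once j a b rfl l hl, ?_⟩
  intro hadj
  -- Take the last letter `l` of `a` adjacent to `j`. The letters after it fix `α_j`, then `s_l`
  -- adds `α_l`, and no earlier letter `l` can remove it, contradicting `a (α_j) = α_j`.
  obtain ⟨x, l, y, hxy, hlj, hy⟩ := exists_first (p := fun m => Adj n m j) (l := a.reverse)
    ⟨l, List.mem_reverse.mpr hl, hadj⟩
  have ha : a = y.reverse ++ l :: x.reverse := by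
    rw [← List.reverse_reverse a, hxy]; simp
  have h1 : wordProd n x.reverse (simpleRoot n j) = simpleRoot n j := by
    refine wordProd_simpleRoot_of_not_adj hn fun m hm => ⟨?_, hy m (List.mem_reverse.mp hm)⟩
    rintro rfl
    exact once m a b rfl m (by rw [ha]; simp [List.mem_reverse.mp hm]) rfl
  have h2 : simpleRefl n l (simpleRoot n j) = simpleRoot n j + simpleRoot n l := by
    have : simpleRoot n j ⬝ᵥ simpleRoot n l = -1 := adj_symm hlj
    rw [simpleRefl_apply, this]; module
  have h3 : l ∉ y.reverse := fun hly =>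
    once l y.reverse (x.reverse ++ j :: b) (by rw [ha]; simp) l hly rfl
  have h4 : l ≠ j := by
    rintro rfl
    exact once l a b rfl l (by rw [ha]; simp) rfl
  have h5 : coweight n l ⬝ᵥ wordProd n a (simpleRoot n j) = coweight n l ⬝ᵥ simpleRoot n j := by
    rw [hroot]
  rw [ha, wordProd_append_apply, wordProd_cons_apply, h1, h2, coweight_dotProduct_wordProd hn h3,
    dotProduct_add, coweight_dotProduct hn h4, zero_add] at h5
  exact (coweight_dotProduct_self_pos hn l).ne' h5

/-- A quiver is determined by its twisted Coxeter element. -/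
theorem eq_of_coxeterOf_eq (hn : 2 ≤ n) {Q Q' : TwistedDynkinQuiver n} {w w' : Word n}
    (h : Q.Adapted w) (hc : ∀ v < n, vcount n v w = 1)
    (h' : Q'.Adapted w') (hc' : ∀ v < n, vcount n v w' = 1)
    (he : coxeterOf n w = coxeterOf n w') : Q = Q' := by
  -- Common sinks can be reflected in both quivers, conjugating both elements by the same
  -- reflection. So every word adapted to `Q` is adapted to `Q'`.
  have key : ∀ (u : Word n) (Q Q' : TwistedDynkinQuiver n) (w w' : Word n),
      Q.Adapted w → (∀ v < n, vcount n v w = 1) → Q'.Adapted w' → (∀ v < n, vcount n v w' = 1) →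
      coxeterOf n w = coxeterOf n w' → Q.Adapted u → Q'.Adapted u := by
    intro u
    induction u with
    | nil => intros; trivial
    | cons i u ih =>
      intro Q Q' w w' h hc h' hc' he hu
      have hi := isSink_of_coxeterOf_eq hn h hc h' hc' he hu.1
      obtain ⟨s, hs, hsc⟩ := exists_adapted_const hn (Q.reflect i) 1
      obtain ⟨s', hs', hsc'⟩ := exists_adapted_const hn (Q'.reflect i) 1
      refine ⟨hi, ih _ _ s s' hs hsc hs' hsc' ?_ hu.2⟩
      rw [coxeterOf_reflect hn hu.1 h hc hs hsc, coxeterOf_reflect hn hi h' hc' hs' hsc', he]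
  exact Adapted.unique hn h (key w Q Q' w w' h hc h' hc' he h) fun v hv => by rw [hc v hv]; omega

end Coxeter

/-! ### Invariance of the AR-quiver under commutation -/

section Correspondence

theorem getElem?_swap {α : Type*} (a b : List α) (x y : α) (k : ℕ) :
    (a ++ y :: x :: b)[Equiv.swap a.length (a.length + 1) k]? = (a ++ x :: y :: b)[k]? := by
  rcases lt_trichotomy k a.length with h | rfl | h
  · rw [Equiv.swap_apply_of_ne_of_ne (by omega) (by omega), List.getElem?_append_left h,
      List.getElem?_append_left h]
  · rw [Equiv.swap_apply_left]; simp
  · obtain ⟨d, rfl⟩ : ∃ d, k = a.length + 1 + d := ⟨k - (a.length + 1), by omega⟩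
    cases d with
    | zero => rw [add_zero, Equiv.swap_apply_right]; simp
    | succ d =>
      rw [Equiv.swap_apply_of_ne_of_ne (by omega) (by omega), List.getElem?_append_right (by omega),
        List.getElem?_append_right (by omega), show a.length + 1 + (d + 1) - a.length = d + 2 by omega]
      simp

/-- A rearrangement of a word that preserves roots, letters, and the order of the letters that are
equal or adjacent. -/
def Rearranged (n : ℕ) (u v : Word n) : Prop :=
  ∃ e : Fin u.length ≃ Fin v.length, (∀ k, v.get (e k) = u.get k) ∧
    (∀ k, wordRoot n v (e k) = wordRoot n u k) ∧
    ∀ k l, u.get k = u.get l ∨ Adj n (u.get k) (u.get l) → (e k < e l ↔ k < l)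

theorem Rearranged.refl (u : Word n) : Rearranged n u u :=
  ⟨Equiv.refl _, fun _ => rfl, fun _ => rfl, fun _ _ _ => Iff.rfl⟩

theorem CommStep.rearranged (hn : 2 ≤ n) {u v : Word n} (h : CommStep n u v) :
    Rearranged n u v := by
  obtain ⟨a, b, i, j, hc, rfl, rfl⟩ := h
  by_cases hij : i = j
  · subst hij; exact Rearranged.refl _
  have hadj := not_adj_of_commute hn hc
  have hadj' : ¬ Adj n j i := fun h => hadj (adj_symm h)
  let s : Equiv.Perm ℕ := Equiv.swap a.length (a.length + 1)
  have hs : ∀ k, s k = if k = a.length then a.length + 1 else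
    if k = a.length + 1 then a.length else k := fun k => Equiv.swap_apply_def _ _ _
  have hlt : ∀ k, k < (a ++ i :: j :: b).length → s k < (a ++ j :: i :: b).length := by
    intro k hk
    simp only [List.length_append, List.length_cons] at hk ⊢
    rw [hs]
    split_ifs <;> omega
  have hlt' : ∀ k, k < (a ++ j :: i :: b).length → s k < (a ++ i :: j :: b).length := by
    intro k hk
    simp only [List.length_append, List.length_cons] at hk ⊢
    rw [hs]
    split_ifs <;> omega
  have hss : ∀ k, s (s k) = k := fun k => Equiv.swap_apply_self _ _ _
  have hletter : ∀ k : Fin (a ++ i :: j :: b).length,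
      (a ++ j :: i :: b).get ⟨s k, hlt k k.2⟩ = (a ++ i :: j :: b).get k := by
    intro k
    have := getElem?_swap a b i j k
    rwa [List.getElem?_eq_getElem (hlt k k.2), List.getElem?_eq_getElem k.2, Option.some_inj]
      at this
  refine ⟨⟨fun k => ⟨s k, hlt k k.2⟩, fun k => ⟨s k, hlt' k k.2⟩, fun k => Fin.ext (hss k),
    fun k => Fin.ext (hss k)⟩, hletter, fun k => ?_, fun k l hkl => ?_⟩
  -- Exchanging two distinct commuting letters exchanges their two roots and leaves the others in
  -- place.
  · have e1 : rootsOf n (a ++ i :: j :: b) = rootsOf n a ++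
        wordProd n a (simpleRoot n i) :: wordProd n a (simpleRoot n j) ::
          (rootsOf n b).map (wordProd n a ∘ (simpleRefl n i * simpleRefl n j)) := by
      rw [rootsOf_append, rootsOf, rootsOf]
      simp [simpleRefl_simpleRoot_of_not_adj hn hij hadj, Function.comp_def]
    have e2 : rootsOf n (a ++ j :: i :: b) = rootsOf n a ++
        wordProd n a (simpleRoot n j) :: wordProd n a (simpleRoot n i) ::
          (rootsOf n b).map (wordProd n a ∘ (simpleRefl n i * simpleRefl n j)) := by
      rw [hc, rootsOf_append, rootsOf, rootsOf]
      simp [simpleRefl_simpleRoot_of_not_adj hn (Ne.symm hij) hadj', Function.comp_def]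
    have := getElem?_swap (rootsOf n a)
      ((rootsOf n b).map (wordProd n a ∘ (simpleRefl n i * simpleRefl n j)))
      (wordProd n a (simpleRoot n i)) (wordProd n a (simpleRoot n j)) k
    rw [← e1, ← e2, length_rootsOf, List.getElem?_eq_getElem (by
      rw [length_rootsOf]; exact hlt k k.2), List.getElem?_eq_getElem (by
      rw [length_rootsOf]; exact k.2), Option.some_inj] at this
    rw [wordRoot_eq, wordRoot_eq]
    exact this
  · have hm : ∀ k : Fin (a ++ i :: j :: b).length, (k : ℕ) = a.length →
        (a ++ i :: j :: b).get k = i := by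
      rintro ⟨k, hk⟩ rfl; simp
    have hm' : ∀ k : Fin (a ++ i :: j :: b).length, (k : ℕ) = a.length + 1 →
        (a ++ i :: j :: b).get k = j := by
      rintro ⟨k, hk⟩ rfl; simp
    have h1 : ¬ ((k : ℕ) = a.length ∧ (l : ℕ) = a.length + 1) := by
      rintro ⟨h1, h2⟩
      rw [hm k h1, hm' l h2] at hkl
      exact hkl.elim hij hadj
    have h2 : ¬ ((k : ℕ) = a.length + 1 ∧ (l : ℕ) = a.length) := by
      rintro ⟨h1, h2⟩
      rw [hm' k h1, hm l h2] at hkl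
      exact hkl.elim (Ne.symm hij) hadj'
    change s k < s l ↔ (k : ℕ) < l
    rw [hs, hs]
    split_ifs <;> omega

theorem Rearranged.residue {u v : Word n} (h : Rearranged n u v) {β : PosRoot n}
    {i : Fin (n + 1)} (hr : (arQuiver n u).residue β i) : (arQuiver n v).residue β i := by
  obtain ⟨e, h1, h2, -⟩ := h
  obtain ⟨k, hk, hi⟩ := hr
  exact ⟨e k, (h2 k).trans hk, (h1 k).trans hi⟩

/-- The conditions for an arrow compare only positions of equal or adjacent letters, and these
comparisons are preserved. -/
theorem Rearranged.arrow {u v : Word n} (h : Rearranged n u v) {α β : PosRoot n}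
    (hr : (arQuiver n u).arrow α β) : (arQuiver n v).arrow α β := by
  obtain ⟨e, h1, h2, h3⟩ := h
  obtain ⟨k, j, hk, hj, hadj, hlt, hj', hk'⟩ := hr
  have hadj' := adj_symm hadj
  refine ⟨e k, e j, (h2 k).trans hk, (h2 j).trans hj, by rwa [h1, h1],
    (h3 _ _ (Or.inr hadj')).mpr hlt, fun m => ?_, fun m => ?_⟩ <;>
  obtain ⟨m, rfl⟩ := e.surjective m <;> intro hm1 hm2 hm <;> rw [h1, h1] at hm
  · exact hj' m ((h3 _ _ (Or.inl hm.symm)).mp hm1)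
      ((h3 _ _ (Or.inr (by rwa [hm]))).mp hm2) hm
  · exact hk' m ((h3 _ _ (Or.inr (by rwa [hm]))).mp hm1)
      ((h3 _ _ (Or.inl hm)).mp hm2) hm

/-- Commutation equivalent words have the same combinatorial AR-quiver. -/
theorem CommEquiv.arQuiver (hn : 2 ≤ n) {u v : Word n} (h : CommEquiv n u v) :
    arQuiver n u = arQuiver n v := by
  refine (CommEquiv.iff_of_step (p := fun w => TwistedD.arQuiver n u = TwistedD.arQuiver n w)
    (fun s t h hs => hs.trans ?_) h).mp rfl
  have h1 := h.rearranged hn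
  have h2 := h.symm.rearranged hn
  refine RootQuiver.ext ?_ ?_
  · funext β i
    exact propext ⟨h1.residue, h2.residue⟩
  · funext α β
    exact propext ⟨h1.arrow, h2.arrow⟩

theorem arQuiver_eq_of_mem (hn : 2 ≤ n) {Q : TwistedDynkinQuiver n} {w w' : Word n}
    (h : w ∈ Q.adaptedClass) (h' : w' ∈ Q.adaptedClass) : arQuiver n w = arQuiver n w' := by
  rw [adaptedClass_eq_commClass hn h] at h'
  exact CommEquiv.arQuiver hn h'

/-! ### Recovering the quiver from orders and AR-quivers -/

/-- A quiver is determined by the order of the roots of adjacent consecutive letters. -/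
theorem eq_of_wordOrder (hn : 2 ≤ n) {Q Q' : TwistedDynkinQuiver n}
    (H : ∀ w' ∈ Q'.adaptedClass, ∀ w ∈ Q.adaptedClass, ∀ a x y b, w' = a ++ x :: y :: b →
      Adj n x y → ∀ β γ : PosRoot n, β.1 = wordProd n a (simpleRoot n x) →
        γ.1 = wordProd n (a ++ [x]) (simpleRoot n y) → wordOrder n w β γ) : Q = Q' := by
  obtain ⟨w, hw⟩ := adaptedClass_nonempty hn Q
  have hw' := (mem_adaptedClass_iff hn).mp hw
  have hnodup := hw.1.1.nodup_rootsOf hn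
  -- Prefixes of `w` are shown to be adapted to `Q'`, one letter at a time; the full word then
  -- identifies the quiver.
  have key : ∀ u t, w = u ++ t → Q'.Adapted u := by
    intro u
    induction u using List.reverseRecOn with
    | nil => intros; trivial
    | append_singleton u i ih =>
      intro t hwt
      rw [List.append_assoc, List.singleton_append] at hwt
      have hu := ih _ hwt
      -- Among the words of `[Q']` that begin with `u`, the gap `a` between `u` and the letter
      -- carrying the root of `i` is made as short as possible.
      let P : ℕ → Prop := fun m => ∃ a j b, a.length = m ∧
        u ++ (a ++ j :: b) ∈ Q'.adaptedClass ∧ wordProd n a (simpleRoot n j) = simpleRoot n i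
      have hP : ∃ m, P m := by
        obtain ⟨s, hs, hsc⟩ := exists_completion hn hu (n + 1) fun v hv => by
          rw [← hw'.2 v hv, hwt, vcount_append]; omega
        have h1 : wordProd n u (simpleRoot n i) ∈ rootsOf n (u ++ s) := by
          refine mem_rootsOf_of_wordProd_eq hn (wordProd_of_complete hn hs hsc) ?_
          rw [hwt] at hw
          exact hw.1.1.isPosRoot_wordProd hn
        rw [rootsOf_append, List.mem_append] at h1
        rcases h1 with h1 | h1
        · rw [hwt, rootsOf_append, List.nodup_append] at hnodup
          exact absurd rfl (hnodup.2.2 _ h1 _ (by rw [rootsOf]; simp))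
        · rw [List.mem_map_of_injective (wordProd_injective hn u), mem_rootsOf] at h1
          obtain ⟨a, j, b, rfl, hj⟩ := h1
          exact ⟨_, a, j, b, rfl, (mem_adaptedClass_iff hn).mpr ⟨hs, hsc⟩, hj⟩
      classical
      obtain ⟨a, j, b, ha, hmem, hroot⟩ := Nat.find_spec hP
      rcases List.eq_nil_or_concat a with rfl | ⟨a, x, rfl⟩
      · rw [wordProd_nil, Module.End.one_apply] at hroot
        rw [simpleRoot_injective hn hroot] at hmem
        refine ((adapted_append Q' (u ++ [i]) b).mp ?_).1
        have := hmem.2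
        simpa using this
      · exfalso
        rw [List.concat_eq_append] at *
        have e : u ++ (a ++ [x] ++ j :: b) = (u ++ a) ++ x :: j :: b := by simp
        rw [e] at hmem
        have hpos : IsPosRoot n (wordProd n (u ++ a) (simpleRoot n x)) :=
          hmem.1.1.isPosRoot_wordProd hn
        have hpos' : IsPosRoot n (wordProd n (u ++ a ++ [x]) (simpleRoot n j)) := by
          refine IsReduced.isPosRoot_wordProd hn (t := b) ?_
          rw [List.append_assoc, List.singleton_append]
          exact hmem.1.1
        by_cases hadj : Adj n x j
        -- If `x` and `j` are adjacent, the root of `x` precedes that of `i` in `w`, so it is a root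
        -- of `u`. In the word of `[Q']` it occurs after `u`, contradicting distinctness.
        · obtain ⟨p, q, hpq, hp, hq⟩ := H _ hmem w hw (u ++ a) x j b rfl hadj ⟨_, hpos⟩ ⟨_, hpos'⟩
            rfl rfl
          rw [wordRoot_eq] at hp hq
          have hq' : (q : ℕ) = u.length := by
            have h1 : (rootsOf n w)[u.length]? = some (wordProd n u (simpleRoot n i)) := by
              rw [hwt, rootsOf_append, rootsOf, List.getElem?_append_right (by simp)]
              simp
            rw [List.getElem?_eq_some_iff] at h1
            obtain ⟨h1, h2⟩ := h1
            have h3 : wordProd n (u ++ a ++ [x]) (simpleRoot n j) =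
                wordProd n u (simpleRoot n i) := by
              rw [List.append_assoc, wordProd_append_apply, hroot]
            replace hq := hq.trans (h3.trans h2.symm)
            exact (hnodup.getElem_inj_iff).mp hq
          have hpu : wordProd n (u ++ a) (simpleRoot n x) ∈ rootsOf n u := by
            have h1 : ∀ m < u.length, (rootsOf n w)[m]? = (rootsOf n u)[m]? := by
              intro m hm
              rw [hwt, rootsOf_append, List.getElem?_append_left (by rwa [length_rootsOf])]
            replace h1 := h1 p (by rw [← hq']; exact hpq)
            rw [List.getElem?_eq_getElem (by simp), hp] at h1
            exact List.mem_of_getElem? h1.symm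
          have h3 := hmem.1.1.nodup_rootsOf hn
          rw [List.append_assoc, rootsOf_append, List.nodup_append] at h3
          refine h3.2.2 _ hpu _ ?_ rfl
          rw [wordProd_append_apply]
          exact List.mem_map_of_mem (mem_rootsOf.mpr ⟨a, x, j :: b, rfl, rfl⟩)
        · have hxj : x ≠ j := by
            rintro rfl
            rw [wordProd_append_apply, wordProd_singleton, simpleRefl_simpleRoot_self hn, map_neg]
              at hpos'
            exact hpos.not_neg hpos'
          -- If `x` and `j` commute, exchanging them shortens the gap, against minimality.
          have hstep : CommStep n ((u ++ a) ++ x :: j :: b) ((u ++ a) ++ j :: x :: b) :=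
            ⟨u ++ a, b, x, j, simpleRefl_commute_of_not_adj hn hadj, rfl, rfl⟩
          refine Nat.find_min hP (m := a.length) (by rw [← ha]; simp) ⟨a, j, x :: b, rfl, ?_, ?_⟩
          · rw [← List.append_assoc, adaptedClass_eq_commClass hn hmem]
            exact .rel _ _ hstep
          · rw [← hroot, wordProd_append_apply, wordProd_singleton,
              simpleRefl_simpleRoot_of_not_adj hn hxj hadj]
  exact Adapted.unique hn hw'.1 (key w [] (by simp)) fun v hv => by rw [hw'.2 v hv]; omega

theorem wordRoot_append_cons (a b : Word n) (x : Fin (n + 1))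
    (h : a.length < (a ++ x :: b).length) :
    wordRoot n (a ++ x :: b) ⟨a.length, h⟩ = wordProd n a (simpleRoot n x) := by
  simp [wordRoot]

/-- Adjacent consecutive letters give an arrow of the combinatorial AR-quiver. -/
theorem arrow_of_adj {a b : Word n} {x y : Fin (n + 1)} (h : Adj n x y) {β γ : PosRoot n}
    (hβ : β.1 = wordProd n a (simpleRoot n x)) (hγ : γ.1 = wordProd n (a ++ [x]) (simpleRoot n y)) :
    (arQuiver n (a ++ x :: y :: b)).arrow γ β := by
  refine ⟨⟨a.length + 1, by simp⟩, ⟨a.length, by simp⟩, ?_, ?_, ?_, ?_, ?_, ?_⟩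
  · rw [hγ]; simp [wordRoot, List.take_append, List.take_of_length_le (Nat.le_succ a.length)]
  · rw [hβ, wordRoot_append_cons]
  · simpa using adj_symm h
  · simp
  · rintro ⟨m, hm⟩ h1 h2
    simp at h1 h2
    omega
  · rintro ⟨m, hm⟩ h1 h2
    simp at h1 h2
    omega

theorem wordOrder_of_arrow {w : Word n} {β γ : PosRoot n} (h : (arQuiver n w).arrow γ β) :
    wordOrder n w β γ := by
  obtain ⟨k, j, hk, hj, -, hlt, -, -⟩ := h
  exact ⟨j, k, hlt, hj, hk⟩

theorem eq_of_arQuiver_eq (hn : 2 ≤ n) {Q Q' : TwistedDynkinQuiver n} {w w' : Word n}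
    (h : w ∈ Q.adaptedClass) (h' : w' ∈ Q'.adaptedClass) (he : arQuiver n w = arQuiver n w') :
    Q = Q' := by
  refine eq_of_wordOrder hn fun u' hu' u hu a x y b hab hadj β γ hβ hγ => wordOrder_of_arrow ?_
  rw [arQuiver_eq_of_mem hn hu h, he, arQuiver_eq_of_mem hn h' hu', hab]
  exact arrow_of_adj hadj hβ hγ

/-- Adjacent consecutive letters of one word give an arrow of the AR-quiver shared by the class, so
their roots are ordered alike in all its words and hence in the convex order. -/
theorem eq_of_convexOrder_eq (hn : 2 ≤ n) {Q Q' : TwistedDynkinQuiver n}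
    (he : convexOrder n Q.adaptedClass = convexOrder n Q'.adaptedClass) : Q = Q' := by
  refine eq_of_wordOrder hn fun u' hu' u hu a x y b hab hadj β γ hβ hγ => ?_
  have h1 : convexOrder n Q'.adaptedClass β γ := by
    intro w hw
    apply wordOrder_of_arrow
    rw [arQuiver_eq_of_mem hn hw hu', hab]
    exact arrow_of_adj hadj hβ hγ
  rw [← he] at h1
  exact h1 u hu

theorem eq_of_adaptedClass_eq (hn : 2 ≤ n) {Q Q' : TwistedDynkinQuiver n}
    (he : Q.adaptedClass = Q'.adaptedClass) : Q = Q' :=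
  eq_of_convexOrder_eq hn (by rw [he])

/-! ### Reflection functors and reflections of quivers -/

/-- The right reflection functor. -/
theorem rotate_right_mem (hn : 2 ≤ n) {Q : TwistedDynkinQuiver n} {i : Fin (n + 1)} {t : Word n}
    (h : i :: t ∈ Q.adaptedClass) :
    t ++ [(vee n)^[n + 1] i] ∈ (Q.reflect i).adaptedClass := by
  rw [mem_adaptedClass_iff hn] at *
  obtain ⟨ht, hc⟩ := h
  refine ⟨(adapted_append _ _ _).mpr ⟨ht.2, ?_⟩, fun v hv => ?_⟩
  -- A complete word turns `Q` into its `(n + 1)`-fold twist, whose sinks are the images of those of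
  -- `Q` under `∨^(n+1)`.
  · rw [← after_cons, after_eq_twist hn ht hc]
    exact ⟨IsSink.twist_iterate hn ht.1 _, trivial⟩
  · have := hc v hv
    rw [vcount_cons] at this
    rw [vcount_append, vcount_cons, vcount_nil, vertex_vee_iterate]
    omega

theorem twist_iterate_twist_iterate (Q : TwistedDynkinQuiver n) (m : ℕ) :
    twist^[m] (twist^[m] Q) = Q := by
  refine TwistedDynkinQuiver.ext ?_ ?_
  · rw [swapped_twist_iterate, swapped_twist_iterate]; simp
  · rw [toRight_twist_iterate, toRight_twist_iterate]

/-- The left reflection functor. -/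
theorem exists_rotate_left_mem (hn : 2 ≤ n) {Q : TwistedDynkinQuiver n} {i : Fin (n + 1)}
    {t : Word n} (h : t ++ [i] ∈ Q.adaptedClass) :
    ∃ Q' : TwistedDynkinQuiver n, (vee n)^[n + 1] i :: t ∈ Q'.adaptedClass := by
  simp only [mem_adaptedClass_iff hn] at *
  obtain ⟨ht, hc⟩ := h
  obtain ⟨ht', hi⟩ := (adapted_append _ _ _).mp ht
  -- Just after reflecting at `i`, every channel touched by `i` stores the opposite of its signal;
  -- for a fork letter this means that `i` is now hidden.
  have h1 : Opposed (twist^[n + 1] Q) i := by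
    rw [← after_eq_twist hn ht hc, after_append]
    intro c b hb
    change state ((after Q t).reflect i) c = !b
    rw [state_reflect hn hi.1, (isSink_iff hn _ _).mp hi.1 c b hb, hb]
    simp
  have h2 := h1.twist_iterate hn (n + 1)
  rw [twist_iterate_twist_iterate] at h2
  set j := (vee n)^[n + 1] i with hj
  -- Flipping the channels of `j` undoes a reflection: `j` becomes a sink of `Q'`, and reflecting
  -- there returns `Q`.
  let Q' : TwistedDynkinQuiver n := ofState fun c => xor (state Q c) (signal n c j).isSome
  have hsink : Q'.IsSink j := by
    rw [isSink_iff hn]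
    intro c b hb
    rw [state_ofState, h2 c b hb, hb]
    simp
  have hQ : Q'.reflect j = Q := by
    apply state_ext
    intro c
    rw [state_reflect hn hsink, state_ofState]
    simp
  refine ⟨Q', ⟨hsink, by rw [hQ]; exact ht'⟩, fun v hv => ?_⟩
  have := hc v hv
  rw [vcount_append, vcount_cons, vcount_nil] at this
  rw [vcount_cons, hj, vertex_vee_iterate]
  omega

/-- Since `w₀ = -σ^(n+1)`, the involution `i ↦ i^*` is `∨^(n+1)`. -/
theorem eq_vee_iterate_of_wordProd (hn : 2 ≤ n) {Q : TwistedDynkinQuiver n} {w : Word n}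
    (h : w ∈ Q.adaptedClass) {i j : Fin (n + 1)} :
    wordProd n w (simpleRoot n i) = -simpleRoot n j ↔ j = (vee n)^[n + 1] i := by
  rw [mem_adaptedClass_iff hn] at h
  rw [wordProd_of_complete hn h.1 h.2, LinearMap.neg_apply, sigma_pow_simpleRoot hn, neg_inj,
    (simpleRoot_injective hn).eq_iff, eq_comm]

/-- The twisted adapted classes are the classes of the twisted Dynkin quivers. -/
theorem twistedAdaptedClasses_eq (hn : 2 ≤ n) :
    twistedAdaptedClasses n = Set.range fun Q : TwistedDynkinQuiver n => Q.adaptedClass := by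
  obtain ⟨Q₀, h₀⟩ := exists_quiver_adapted hn (vcount_baseWord (n := n))
  have hbase : commClass n (twistedPower n ((List.finRange n).map Fin.castSucc)) =
      Q₀.adaptedClass := by
    refine (adaptedClass_eq_commClass hn ((mem_adaptedClass_iff hn).mpr ?_)).symm
    exact adapted_twistedPower hn h₀ vcount_baseWord
  rw [twistedAdaptedClasses, hbase]
  ext c
  constructor
  · intro hc
    induction (hc : Relation.ReflTransGen (ReflectionStep n) Q₀.adaptedClass c) with
    | refl => exact ⟨Q₀, rfl⟩
    | tail _ hstep ih =>
      obtain ⟨Q, rfl⟩ := ih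
      rcases hstep with ⟨i, j, w, hw, hprod, rfl⟩ | ⟨i, j, w, hw, hprod, rfl⟩
      · rw [eq_vee_iterate_of_wordProd hn hw] at hprod
        subst hprod
        exact ⟨_, adaptedClass_eq_commClass hn (rotate_right_mem hn hw)⟩
      · rw [eq_vee_iterate_of_wordProd hn hw] at hprod
        subst hprod
        obtain ⟨Q', hQ'⟩ := exists_rotate_left_mem hn hw
        exact ⟨Q', adaptedClass_eq_commClass hn hQ'⟩
  · rintro ⟨Q, rfl⟩
    refine forall_quiver_of_reflect hn
      (p := fun Q => Q.adaptedClass ∈ clusterPoint n Q₀.adaptedClass) ?_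
      (Q₀ := Q₀) Relation.ReflTransGen.refl Q
    intro Q i hi hQ
    refine Relation.ReflTransGen.tail hQ (Or.inl ?_)
    have h1 : Q.Adapted [i] := ⟨hi, trivial⟩
    obtain ⟨t, ht, htc⟩ := exists_completion hn h1 (n + 1) (by
      intro v hv
      rw [vcount_cons, vcount_nil]
      split_ifs <;> omega)
    have hmem : i :: t ∈ Q.adaptedClass := (mem_adaptedClass_iff hn).mpr ⟨ht, htc⟩
    exact ⟨i, _, t, hmem, (eq_vee_iterate_of_wordProd hn hmem).mpr rfl,
      adaptedClass_eq_commClass hn (rotate_right_mem hn hmem)⟩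

/-! ### Counting and assembly -/

theorem card_twistedDynkinQuiver (hn : 1 ≤ n) : Nat.card (TwistedDynkinQuiver n) = 2 ^ n := by
  let e : TwistedDynkinQuiver n ≃ Bool × (Fin (n - 1) → Bool) :=
    ⟨fun Q => (Q.swapped, Q.toRight), fun p => ⟨p.1, p.2⟩, fun _ => rfl, fun _ => rfl⟩
  rw [Nat.card_congr e, Nat.card_prod, Nat.card_fun]
  simp only [Nat.card_eq_fintype_card, Fintype.card_bool, Fintype.card_fin]
  rw [← pow_succ', Nat.sub_add_cancel hn]

theorem ncard_of_bijOn_univ {α β : Type*} {f : α → β} {s : Set β} (h : Set.BijOn f Set.univ s) :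
    s.ncard = Nat.card α := by
  rw [← h.image_eq, h.injOn.ncard_image, Set.ncard_univ]

end Correspondence

end TwistedD

end

theorem theorem7p11 (n : ℕ) (hn : 2 ≤ n) :
    ∃ (φ : TwistedDynkinQuiver n → Module.End ℝ (V n))
      (Υ : TwistedDynkinQuiver n → RootQuiver n),
      -- `φ Q` is the twisted Coxeter element adapted to `Q`
      (∀ Q : TwistedDynkinQuiver n, ∃ w : Word n, IsTransversal n w ∧ Q.Adapted w) ∧
      (∀ (Q : TwistedDynkinQuiver n) (w : Word n), IsTransversal n w → Q.Adapted w →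
        φ Q = coxeterOf n w) ∧
      -- `Υ Q` is the combinatorial AR-quiver of every word in `[Q]`
      (∀ (Q : TwistedDynkinQuiver n), ∀ w ∈ Q.adaptedClass, Υ Q = arQuiver n w) ∧
      -- `[Q]` is the commutation class attached to the twisted Coxeter element `φ Q`
      (∀ (Q : TwistedDynkinQuiver n) (w : Word n), IsTransversal n w → φ Q = coxeterOf n w →
        Q.adaptedClass = commClass n (twistedPower n w)) ∧
      -- the one-to-one correspondences
      Set.BijOn (fun Q : TwistedDynkinQuiver n => Q.adaptedClass) Set.univ
        (twistedAdaptedClasses n) ∧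
      Set.BijOn φ Set.univ (twistedCoxeterElements n) ∧
      Set.BijOn (fun Q : TwistedDynkinQuiver n => convexOrder n Q.adaptedClass) Set.univ
        (twistedConvexOrders n) ∧
      Set.BijOn Υ Set.univ (twistedARQuivers n) ∧
      -- all five families have `2 ^ n` members
      Nat.card (TwistedDynkinQuiver n) = 2 ^ n ∧
      (twistedAdaptedClasses n).ncard = 2 ^ n ∧
      (twistedCoxeterElements n).ncard = 2 ^ n ∧
      (twistedConvexOrders n).ncard = 2 ^ n ∧
      (twistedARQuivers n).ncard = 2 ^ n := by
  classical
  -- Representatives are chosen arbitrarily; the twisted Coxeter element and the AR-quiver do not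
  -- depend on the choice.
  choose tw htw htc using fun Q : TwistedDynkinQuiver n => exists_adapted_const hn Q 1
  choose cw hcw using fun Q : TwistedDynkinQuiver n => adaptedClass_nonempty hn Q
  have hcls : Set.BijOn (fun Q : TwistedDynkinQuiver n => Q.adaptedClass) Set.univ
      (twistedAdaptedClasses n) := by
    rw [twistedAdaptedClasses_eq hn, ← Set.image_univ]
    exact Set.InjOn.bijOn_image fun Q _ Q' _ h => eq_of_adaptedClass_eq hn h
  have hcox : Set.BijOn (fun Q : TwistedDynkinQuiver n => coxeterOf n (tw Q)) Set.univ
      (twistedCoxeterElements n) := by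
    refine ⟨fun Q _ => ⟨tw Q, (isTransversal_iff hn _).mpr (htc Q), rfl⟩, fun Q _ Q' _ h =>
      eq_of_coxeterOf_eq hn (htw Q) (htc Q) (htw Q') (htc Q') h, ?_⟩
    rintro f ⟨w, hw, rfl⟩
    rw [isTransversal_iff hn] at hw
    obtain ⟨Q, hQ⟩ := exists_quiver_adapted hn hw
    exact ⟨Q, trivial, coxeterOf_eq_of_adapted hn (htw Q) (htc Q) hQ hw⟩
  have hord : Set.BijOn (fun Q : TwistedDynkinQuiver n => convexOrder n Q.adaptedClass) Set.univ
      (twistedConvexOrders n) := by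
    refine ⟨fun Q _ => ⟨_, hcls.mapsTo (Set.mem_univ Q), rfl⟩, fun Q _ Q' _ h =>
      eq_of_convexOrder_eq hn h, ?_⟩
    rintro r ⟨c, hc, rfl⟩
    obtain ⟨Q, -, rfl⟩ := hcls.surjOn hc
    exact ⟨Q, trivial, rfl⟩
  have har : Set.BijOn (fun Q : TwistedDynkinQuiver n => arQuiver n (cw Q)) Set.univ
      (twistedARQuivers n) := by
    refine ⟨fun Q _ => ⟨_, hcls.mapsTo (Set.mem_univ Q), cw Q, hcw Q, rfl⟩, fun Q _ Q' _ h =>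
      eq_of_arQuiver_eq hn (hcw Q) (hcw Q') h, ?_⟩
    rintro Y ⟨c, hc, w, hw, rfl⟩
    obtain ⟨Q, -, rfl⟩ := hcls.surjOn hc
    exact ⟨Q, trivial, arQuiver_eq_of_mem hn (hcw Q) hw⟩
  have hcard := card_twistedDynkinQuiver (n := n) (by omega)
  refine ⟨fun Q => coxeterOf n (tw Q), fun Q => arQuiver n (cw Q), fun Q =>
    ⟨tw Q, (isTransversal_iff hn _).mpr (htc Q), htw Q⟩, fun Q w hw h =>
    coxeterOf_eq_of_adapted hn (htw Q) (htc Q) h ((isTransversal_iff hn _).mp hw), fun Q w hw =>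
    arQuiver_eq_of_mem hn (hcw Q) hw, fun Q w hw h => ?_, hcls, hcox, hord, har, hcard,
    (ncard_of_bijOn_univ hcls).trans hcard, (ncard_of_bijOn_univ hcox).trans hcard,
    (ncard_of_bijOn_univ hord).trans hcard, (ncard_of_bijOn_univ har).trans hcard⟩
  rw [isTransversal_iff hn] at hw
  -- The transversal word is adapted to some quiver, which the equality of twisted Coxeter elements
  -- forces to be `Q`.
  obtain ⟨Q', hQ'⟩ := exists_quiver_adapted hn hw
  obtain rfl := eq_of_coxeterOf_eq hn (htw Q) (htc Q) hQ' hw h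
  exact adaptedClass_eq_commClass hn ((mem_adaptedClass_iff hn).mpr (adapted_twistedPower hn hQ' hw))
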